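/- **Setting.** Let $X\neq\{0\}$ be a C*-algebra and $\mathcal F$ a norm-closed subspace of $X^*$ such that $(X,\mathcal F)$ is a dual pair: $\|x\|=\sup\{|\varphi(x)|:\varphi\in\mathcal F,\|\varphi\|\le1\}$ for $x\in X$; the convex hull of every relatively $\mathcal F$-compact subset of $X$ is relatively $\mathcal F$-compact; the convex hull of every relatively $X$-compact subset of $\mathcal F$ is relatively $X$-compact; the involution of $X$ is $\mathcal F$-continuous and its multiplication is separately $\mathcal F$-continuous. Here the $\mathcal F$-topology is $\sigma(X,\mathcal F)$ and the $X$-topology is $\sigma(\mathcal F,X)$. Let $G$ be a compact (Hausdorff) group with normalized Haar measure $dg$ and let $(X,G,\alpha)$ be an $\mathcal F$-dynamical system, that is, $\alpha$ is a homomorphism from $G$ to the group of $\mathcal F$-continuous $*$-automorphisms of $X$ such that $g\mapsto\varphi(\alpha_g(x))$ is continuous for all $x\in X$, $\varphi\in\mathcal F$. **Spectra.** Let $\widehat G$ be the set of unitary equivalence classes of irreducible unitary representations of $G$, with a fixed representative $\pi:G\to U(H_\pi)$, $\dim H_\pi=d_\pi<\infty$, in each class. Put $\chi_\pi(g)=d_\pi\sum_i\overline{\pi_{ii}(g)}$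 and $$X_1(\pi)=\Big\{x\in X:\ \int_G\chi_\pi(g)\alpha_g(x)\,dg=x\Big\},\qquad sp(\alpha)=\{\pi\in\widehat G:X_1(\pi)\neq\{0\}\},$$ the integral being taken weakly against $\mathcal F$. For an $\alpha$-invariant $\mathcal F$-closed C*-subalgebra $Y$ of $X$ let $$Y_2(\pi)=\{a\in Y\otimes B(H_\pi):(\alpha_g\otimes\iota)(a)=a(1\otimes\pi_g)\ \text{for all } g\in G\},$$ let $(Y\otimes B(H_\pi))^{\alpha\otimes ad\pi}$ be the fixed-point algebra of the action $a\mapsto(1\otimes\pi_g)\,(\alpha_g\otimes\iota)(a)\,(1\otimes\pi_{g^{-1}})$ of $G$ on $Y\otimes B(H_\pi)$, and let $Y_2(\pi)^*Y_2(\pi)$ be the linear span of the products $a^*b$ with $a,b\in Y_2(\pi)$. Write $\overline{\,\cdot\,}^{\sigma}$ for closure in the $\mathcal F$-topology, respectively in the topology of $X\otimes B(H_\pi)$ given by $\mathcal F\otimes B(H_\pi)^*$. The strong Connes spectrum $\widetilde\Gamma_{\mathcal F}(\alpha)$ is the set of all $\pi\in\widehat G$ such that $$\overline{Y_2(\pi)^*Y_2(\pi)}^{\sigma}=(Y\otimes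 B(H_\pi))^{\alpha\otimes ad\pi}$$ for every non-zero globally $\alpha$-invariant $\mathcal F$-closed hereditary C*-subalgebra $Y$ of $X$. **Simplicity.** A subalgebra $B$ of $X\otimes B(H_\pi)$ is $\mathcal F$-simple if every non-zero two-sided ideal of $B$ is dense in $B$ for the topology given by $\mathcal F\otimes B(H_\pi)^*$. $X$ is $\alpha$-simple if every non-zero $\alpha$-invariant two-sided ideal of $X$ is $\mathcal F$-dense in $X$. **Theorem 3.6.** The following are equivalent: i) $(X\otimes B(H_\pi))^{\alpha\otimes ad\pi}$ is $\mathcal F$-simple for all $\pi\in sp(\alpha)$. ii) $X$ is $\alpha$-simple and $sp(\alpha)=\widetilde\Gamma_{\mathcal F}(\alpha)$. -/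

import Mathlib

open MeasureTheory Topology Matrix

noncomputable section

namespace FDyn

/-! ### Dual pairs of Banach spaces -/

section DualPair

variable {X : Type*} [NonUnitalCStarAlgebra X]

/-- The `F`-topology of `X`: the coarsest topology making every `φ ∈ F` continuous. -/
@[reducible] def fTopology (F : Submodule ℂ (StrongDual ℂ X)) : TopologicalSpace X :=
  TopologicalSpace.induced (fun x (φ : F) => φ.1 x) inferInstance

/-- The `X`-topology of `F`: the topology of pointwise convergence on `X`. -/
@[reducible] def xTopology (F : Submodule ℂ (StrongDual ℂ X)) : TopologicalSpace F :=
  TopologicalSpace.induced (fun φ (x : X) => φ.1 x) inferInstance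

/-- `(X, F)` is a dual pair of Banach spaces and `X` is a C*-algebra whose involution is
`F`-continuous and whose multiplication is separately `F`-continuous. The norm of `F` is the one
inherited from the dual of `X`, so the formula `‖φ‖ = sup {|φ x| : ‖x‖ ≤ 1}` for `φ ∈ F` holds
by definition. A set is relatively compact if its closure is compact. -/
structure IsCStarDualPair (F : Submodule ℂ (StrongDual ℂ X)) : Prop where
  isClosed : IsClosed (F : Set (StrongDual ℂ X))
  norm_eq : ∀ x : X, IsLUB {r : ℝ | ∃ φ ∈ F, ‖φ‖ ≤ 1 ∧ r = ‖φ x‖} ‖x‖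
  convexHull_left : ∀ S : Set X, @IsCompact X (fTopology F) (closure[fTopology F] S) →
    @IsCompact X (fTopology F) (closure[fTopology F] (convexHull ℝ S))
  convexHull_right : ∀ S : Set F, @IsCompact F (xTopology F) (closure[xTopology F] S) →
    @IsCompact F (xTopology F) (closure[xTopology F] (convexHull ℝ S))
  continuous_star : Continuous[fTopology F, fTopology F] (fun x : X => star x)
  continuous_mul_left : ∀ a : X, Continuous[fTopology F, fTopology F] (fun x : X => a * x)
  continuous_mul_right : ∀ a : X, Continuous[fTopology F, fTopology F] (fun x : X => x * a)

/-- The topology of `X ⊗ B(ℂⁿ) = Mₙ(X)` given by `F ⊗ B(ℂⁿ)*`. The elements of `F ⊗ B(ℂⁿ)*` are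
the functionals `a ↦ ∑ φᵢⱼ (aᵢⱼ)` with `φᵢⱼ ∈ F`, so this is the coarsest topology making
`a ↦ φ (aᵢⱼ)` continuous for all `φ ∈ F` and all `i, j`. -/
@[reducible] def matTopology (F : Submodule ℂ (StrongDual ℂ X)) (n : ℕ) :
    TopologicalSpace (Matrix (Fin n) (Fin n) X) :=
  TopologicalSpace.induced (fun a (p : Fin n × Fin n × F) => p.2.2.1 (a p.1 p.2.1)) inferInstance

/-- `y = ∫ f dμ` in the weak sense determined by `F`. -/
def IsWeakIntegral {S : Type*} [MeasurableSpace S] (F : Submodule ℂ (StrongDual ℂ X))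
    (μ : Measure S) (f : S → X) (y : X) : Prop :=
  ∀ φ ∈ F, φ y = ∫ s, φ (f s) ∂μ

end DualPair

/-! ### The dual of a compact group -/

section GroupDual

/-- A continuous irreducible unitary representation of `G` on `ℂⁿ`, `n ≥ 1`. -/
structure IrrRep (G : Type*) [Group G] [TopologicalSpace G] where
  dim : ℕ
  dim_pos : 0 < dim
  rep : G →* unitaryGroup (Fin dim) ℂ
  continuous_rep : Continuous rep
  irreducible : ∀ W : Submodule ℂ (Fin dim → ℂ),
    (∀ g, ∀ w ∈ W, (rep g : Matrix (Fin dim) (Fin dim) ℂ) *ᵥ w ∈ W) → W = ⊥ ∨ W = ⊤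

variable {G : Type*} [Group G] [TopologicalSpace G]

/-- The matrix `π_g`. -/
def IrrRep.mat (π : IrrRep G) (g : G) : Matrix (Fin π.dim) (Fin π.dim) ℂ := π.rep g

/-- Unitary equivalence of representations. -/
def IrrRep.UnitarilyEquiv (π σ : IrrRep G) : Prop :=
  ∃ U : Matrix (Fin σ.dim) (Fin π.dim) ℂ,
    Uᴴ * U = 1 ∧ U * Uᴴ = 1 ∧ ∀ g, U * π.mat g = σ.mat g * U

instance irrRepSetoid (G : Type*) [Group G] [TopologicalSpace G] : Setoid (IrrRep G) where
  r := IrrRep.UnitarilyEquiv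
  iseqv :=
    { refl := fun π => ⟨1, by simp, by simp, by simp⟩
      symm := by
        rintro π σ ⟨U, h1, h2, h3⟩
        refine ⟨Uᴴ, by simpa using h2, by simpa using h1, fun g => ?_⟩
        calc Uᴴ * σ.mat g = Uᴴ * (σ.mat g * U) * Uᴴ := by
              rw [Matrix.mul_assoc, Matrix.mul_assoc, h2, Matrix.mul_one]
          _ = (Uᴴ * U) * π.mat g * Uᴴ := by rw [← h3]; simp only [Matrix.mul_assoc]
          _ = π.mat g * Uᴴ := by rw [h1, Matrix.one_mul]
      trans := by
        rintro π σ τ ⟨U, h1, h2, h3⟩ ⟨V, k1, k2, k3⟩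
        refine ⟨V * U, ?_, ?_, fun g => ?_⟩
        · rw [conjTranspose_mul, Matrix.mul_assoc, ← Matrix.mul_assoc Vᴴ, k1, Matrix.one_mul, h1]
        · rw [conjTranspose_mul, Matrix.mul_assoc, ← Matrix.mul_assoc U, h2, Matrix.one_mul, k2]
        · rw [Matrix.mul_assoc, h3, ← Matrix.mul_assoc, k3, Matrix.mul_assoc] }

/-- The set `Ĝ` of unitary equivalence classes of irreducible representations of `G`. -/
def DualSet (G : Type*) [Group G] [TopologicalSpace G] : Type _ := Quotient (irrRepSetoid G)

/-- The fixed representative of a class in `Ĝ`. -/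
def DualSet.rep (c : DualSet G) : IrrRep G := Quotient.out c

/-- `χ_π(g) = d_π ∑ᵢ conj (π_ii(g))`. -/
def IrrRep.chi (π : IrrRep G) (g : G) : ℂ := (π.dim : ℂ) * ∑ i, star (π.mat g i i)

end GroupDual

/-! ### Matrices over `X` multiplied by scalar matrices -/

section ScalarMul

variable {X : Type*} [NonUnitalCStarAlgebra X] {n : ℕ}

/-- `(1 ⊗ u) a` for a scalar matrix `u` and `a ∈ X ⊗ B(ℂⁿ)`. -/
def scalarMul (u : Matrix (Fin n) (Fin n) ℂ) (a : Matrix (Fin n) (Fin n) X) :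
    Matrix (Fin n) (Fin n) X := of fun i j => ∑ k, u i k • a k j

/-- `a (1 ⊗ u)` for a scalar matrix `u` and `a ∈ X ⊗ B(ℂⁿ)`. -/
def mulScalar (a : Matrix (Fin n) (Fin n) X) (u : Matrix (Fin n) (Fin n) ℂ) :
    Matrix (Fin n) (Fin n) X := of fun i j => ∑ k, u k j • a i k

variable (u v : Matrix (Fin n) (Fin n) ℂ) (a b : Matrix (Fin n) (Fin n) X)

lemma mulScalar_mul : mulScalar a u * b = a * scalarMul u b := by
  ext i j
  simp only [mulScalar, scalarMul, Matrix.mul_apply, of_apply, Finset.sum_mul, Finset.mul_sum,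
    smul_mul_assoc, mul_smul_comm]
  exact Finset.sum_comm

lemma scalarMul_mul : scalarMul u (a * b) = scalarMul u a * b := by
  ext i j
  simp only [scalarMul, Matrix.mul_apply, of_apply, Finset.sum_mul, Finset.smul_sum,
    smul_mul_assoc]
  exact Finset.sum_comm

lemma mul_mulScalar : mulScalar (a * b) u = a * mulScalar b u := by
  ext i j
  simp only [mulScalar, Matrix.mul_apply, of_apply, Finset.mul_sum, Finset.smul_sum,
    mul_smul_comm]
  exact Finset.sum_comm

lemma scalarMul_scalarMul : scalarMul u (scalarMul v a) = scalarMul (u * v) a := by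
  ext i j
  simp only [scalarMul, Matrix.mul_apply, of_apply, Finset.smul_sum, Finset.sum_smul, mul_smul]
  exact Finset.sum_comm

lemma one_scalarMul : scalarMul (1 : Matrix (Fin n) (Fin n) ℂ) a = a := by
  ext i j
  simp [scalarMul, Matrix.one_apply, ite_smul]

lemma scalarMul_mulScalar : scalarMul u (mulScalar a v) = mulScalar (scalarMul u a) v := by
  ext i j
  simp only [scalarMul, mulScalar, of_apply, Finset.smul_sum]
  rw [Finset.sum_comm]
  exact Finset.sum_congr rfl fun k _ => Finset.sum_congr rfl fun l _ => smul_comm _ _ _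

lemma conjTranspose_scalarMul : (scalarMul u a)ᴴ = mulScalar aᴴ uᴴ := by
  ext i j
  simp [scalarMul, mulScalar, conjTranspose_apply]

lemma conjTranspose_mulScalar : (mulScalar a u)ᴴ = scalarMul uᴴ aᴴ := by
  ext i j
  simp [scalarMul, mulScalar, conjTranspose_apply]

end ScalarMul

/-! ### Dynamical systems, spectral subspaces and fixed point algebras -/

section System

variable {X : Type*} [NonUnitalCStarAlgebra X] {G : Type*} [Group G] [TopologicalSpace G]

/-- `(X, G, α)` is an `F`-dynamical system: `α` is a homomorphism from `G` to the group of
`F`-continuous *-automorphisms of `X` and `g ↦ φ (α_g x)` is continuous for all `x` and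
`φ ∈ F`. -/
structure IsFDynamicalSystem (F : Submodule ℂ (StrongDual ℂ X)) (α : G →* (X ≃⋆ₐ[ℂ] X)) :
    Prop where
  continuous_aut : ∀ g, Continuous[fTopology F, fTopology F] (α g)
  continuous_orbit : ∀ x : X, ∀ φ ∈ F, Continuous fun g => φ (α g x)

/-- The action `α ⊗ ad π` on `X ⊗ B(H_π)`:
`a ↦ (1 ⊗ π_g) [α_g(aᵢⱼ)] (1 ⊗ π_{g⁻¹})`. -/
def tensorAd (α : G →* (X ≃⋆ₐ[ℂ] X)) (π : IrrRep G) (g : G)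
    (a : Matrix (Fin π.dim) (Fin π.dim) X) : Matrix (Fin π.dim) (Fin π.dim) X :=
  mulScalar (scalarMul (π.mat g) (a.map (α g))) (π.mat g⁻¹)

lemma mat_inv_mul (π : IrrRep G) (g : G) : π.mat g⁻¹ * π.mat g = 1 := by
  have h : π.rep g⁻¹ * π.rep g = 1 := by rw [← map_mul]; simp
  exact congrArg Subtype.val h

lemma mat_inv (π : IrrRep G) (g : G) : π.mat g⁻¹ = (π.mat g)ᴴ := by
  simp only [IrrRep.mat, map_inv]
  rfl

/-- The fixed point algebra `(Y ⊗ B(H_π))^{α ⊗ ad π}` of a subalgebra `Y` of `X`; the case of `X`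
itself is `Y = ⊤`. -/
def fixedAlgebra (α : G →* (X ≃⋆ₐ[ℂ] X)) (Y : NonUnitalStarSubalgebra ℂ X) (π : IrrRep G) :
    NonUnitalStarSubalgebra ℂ (Matrix (Fin π.dim) (Fin π.dim) X) where
  carrier := {a | (∀ i j, a i j ∈ Y) ∧ ∀ g, tensorAd α π g a = a}
  add_mem' := by
    rintro a b ⟨ha, ha'⟩ ⟨hb, hb'⟩
    refine ⟨fun i j => add_mem (ha i j) (hb i j), fun g => ?_⟩
    conv_rhs => rw [← ha' g, ← hb' g]
    ext i j
    simp [tensorAd, mulScalar, scalarMul, smul_add, Finset.sum_add_distrib]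
  zero_mem' := by
    refine ⟨fun i j => zero_mem Y, fun g => ?_⟩
    ext i j
    simp [tensorAd, mulScalar, scalarMul]
  smul_mem' := by
    rintro c a ⟨ha, ha'⟩
    refine ⟨fun i j => SMulMemClass.smul_mem c (ha i j), fun g => ?_⟩
    conv_rhs => rw [← ha' g]
    ext i j
    simp only [tensorAd, mulScalar, scalarMul, of_apply, map_apply, Matrix.smul_apply, map_smul,
      Finset.smul_sum]
    exact Finset.sum_congr rfl fun k _ => Finset.sum_congr rfl fun l _ => by
      rw [smul_comm c, smul_comm c]
  mul_mem' := by
    rintro a b ⟨ha, ha'⟩ ⟨hb, hb'⟩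
    refine ⟨fun i j => ?_, fun g => ?_⟩
    · rw [Matrix.mul_apply]
      exact sum_mem fun k _ => mul_mem (ha i k) (hb k j)
    · have hm : (a * b).map (α g) = a.map (α g) * b.map (α g) := by
        ext i j
        simp [Matrix.mul_apply]
      conv_rhs => rw [← ha' g, ← hb' g]
      simp only [tensorAd]
      rw [hm, mulScalar_mul, scalarMul_mulScalar, scalarMul_scalarMul, mat_inv_mul,
        one_scalarMul, scalarMul_mul, mul_mulScalar]
  star_mem' := by
    rintro a ⟨ha, ha'⟩
    refine ⟨fun i j => star_mem (ha j i), fun g => ?_⟩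
    have hm : (star a).map (α g) = (a.map (α g))ᴴ := by
      ext i j
      simp [star_eq_conjTranspose, conjTranspose_apply, map_star]
    conv_rhs => rw [← ha' g]
    simp only [tensorAd, star_eq_conjTranspose] at hm ⊢
    rw [hm, conjTranspose_mulScalar, conjTranspose_scalarMul, mat_inv, conjTranspose_conjTranspose,
      scalarMul_mulScalar]

/-- The spectral subspace `Y₂(π) = {a ∈ Y ⊗ B(H_π) : (α_g ⊗ ι)(a) = a (1 ⊗ π_g) for all g}`. -/
def spectralSubspaceTwo (α : G →* (X ≃⋆ₐ[ℂ] X)) (Y : NonUnitalStarSubalgebra ℂ X)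
    (π : IrrRep G) : Set (Matrix (Fin π.dim) (Fin π.dim) X) :=
  {a | (∀ i j, a i j ∈ Y) ∧ ∀ g, a.map (α g) = mulScalar a (π.mat g)}

/-- `Y₂(π)* Y₂(π)`, the linear span of the products `a* b` with `a, b ∈ Y₂(π)`. -/
def spectralIdeal (α : G →* (X ≃⋆ₐ[ℂ] X)) (Y : NonUnitalStarSubalgebra ℂ X)
    (π : IrrRep G) : Submodule ℂ (Matrix (Fin π.dim) (Fin π.dim) X) :=
  Submodule.span ℂ {c | ∃ a ∈ spectralSubspaceTwo α Y π, ∃ b ∈ spectralSubspaceTwo α Y π,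
    c = aᴴ * b}

/-- The strong Arveson type spectrum of the restriction of `α` to `Y`: all `π ∈ Ĝ` such that the
`F`-closure of `Y₂(π)* Y₂(π)` is `(Y ⊗ B(H_π))^{α ⊗ ad π}`. -/
def strongArvesonSpectrum (F : Submodule ℂ (StrongDual ℂ X)) (α : G →* (X ≃⋆ₐ[ℂ] X))
    (Y : NonUnitalStarSubalgebra ℂ X) : Set (DualSet G) :=
  {π | closure[matTopology F π.rep.dim]
      (spectralIdeal α Y π.rep : Set (Matrix (Fin π.rep.dim) (Fin π.rep.dim) X)) =
    fixedAlgebra α Y π.rep}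

/-- `Y` is a non-zero globally `α`-invariant `F`-closed hereditary C*-subalgebra of `X`. -/
structure IsInvariantHereditary [PartialOrder X] (F : Submodule ℂ (StrongDual ℂ X))
    (α : G →* (X ≃⋆ₐ[ℂ] X)) (Y : NonUnitalStarSubalgebra ℂ X) : Prop where
  ne_bot : ∃ y ∈ Y, y ≠ 0
  isClosed : IsClosed[fTopology F] (Y : Set X)
  invariant : ∀ g, ∀ y ∈ Y, α g y ∈ Y
  hereditary : ∀ x y : X, 0 ≤ x → x ≤ y → y ∈ Y → x ∈ Y

/-- The strong Connes spectrum `Γ̃_F(α)`. -/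
def strongConnesSpectrum [PartialOrder X] (F : Submodule ℂ (StrongDual ℂ X))
    (α : G →* (X ≃⋆ₐ[ℂ] X)) : Set (DualSet G) :=
  {π | ∀ Y, IsInvariantHereditary F α Y → π ∈ strongArvesonSpectrum F α Y}

/-- `X` is `α`-simple: every non-zero `α`-invariant two-sided ideal is `F`-dense in `X`. -/
def IsAlphaSimple (F : Submodule ℂ (StrongDual ℂ X)) (α : G →* (X ≃⋆ₐ[ℂ] X)) : Prop :=
  ∀ I : Submodule ℂ X, I ≠ ⊥ → (∀ x ∈ I, ∀ b, b * x ∈ I ∧ x * b ∈ I) →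
    (∀ g, ∀ x ∈ I, α g x ∈ I) → closure[fTopology F] (I : Set X) = Set.univ

/-- A subalgebra `B` of `X ⊗ B(ℂⁿ)` is `F`-simple: every non-zero two-sided ideal of `B` is
dense in `B` for the topology given by `F ⊗ B(ℂⁿ)*`. -/
def IsFSimple (F : Submodule ℂ (StrongDual ℂ X)) {n : ℕ}
    (B : NonUnitalStarSubalgebra ℂ (Matrix (Fin n) (Fin n) X)) : Prop :=
  ∀ I : Submodule ℂ (Matrix (Fin n) (Fin n) X), I ≠ ⊥ → (∀ x ∈ I, x ∈ B) →
    (∀ x ∈ I, ∀ b ∈ B, b * x ∈ I ∧ x * b ∈ I) →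
    (B : Set (Matrix (Fin n) (Fin n) X)) ⊆ closure[matTopology F n] (I : Set _)

variable [IsTopologicalGroup G] [CompactSpace G] [MeasurableSpace G] [BorelSpace G]

/-- The spectral subspace `X₁(π) = {x : P_α(π)(x) = x}`, where
`P_α(π)(x) = ∫ χ_π(g) α_g(x) dg` is a weak integral for the normalized Haar measure of `G`. -/
def spectralSubspaceOne (F : Submodule ℂ (StrongDual ℂ X)) (α : G →* (X ≃⋆ₐ[ℂ] X))
    (π : IrrRep G) : Set X :=
  {x | IsWeakIntegral F (Measure.haarMeasure (⊤ : TopologicalSpace.PositiveCompacts G))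
    (fun g => π.chi g • α g x) x}

/-- `sp(α) = {π ∈ Ĝ : X₁(π) ≠ {0}}`. -/
def spectrumOf (F : Submodule ℂ (StrongDual ℂ X)) (α : G →* (X ≃⋆ₐ[ℂ] X)) : Set (DualSet G) :=
  {π | spectralSubspaceOne F α π.rep ≠ {0}}

end System

end FDyn

end

/-!
The elements of `X₂(π)` are the matrices whose rows `a` satisfy `α_g(a_k) = ∑ₘ π_mk(g) a_m`. If
`a` and `b` are such rows, then `∑ₖ a_k b_k*` is a fixed point of `α`, the matrix `(a_k* b_l)` is
a fixed point of `α ⊗ ad π`, and `X₂(π)* X₂(π)` is the span of the latter. By the Peter–Weyl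
theorem the entries of rows span an `F`-dense subspace of every invariant `F`-closed subspace of
`X`. This moves ideals between `X`, its fixed point algebra `X^α` and the algebras
`(X ⊗ B(H_π))^{α ⊗ ad π}`, and both conditions of the theorem turn out to be related to the
`F`-simplicity of `X^α`.

Condition (i) for the trivial representation says that `X^α` is `F`-simple. An invariant ideal
`J ≠ 0` of `X` contains a fixed point `≠ 0`, so that its closure contains `X^α`, which contains an
approximate unit for the rows: `X` is `α`-simple. For a subalgebra `Y` as in the definition of the
strong Connes spectrum, the fixed points of `Y` generate with the rows over `X` an ideal of
`(X ⊗ B(H_π))^{α ⊗ ad π}`, which is dense by (i); cutting it down by fixed points of `Y` on both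
sides yields the density of `Y₂(π)* Y₂(π)`.

Conversely, let `J ≠ 0` be an ideal of `X^α`. The closure `Y` of `J X J*` is an invariant
hereditary subalgebra, and the density of `Y₂(π)* Y₂(π)` for all `π` in the spectrum shows that
the average over `G` of `X w X` lies in the closure of `J` for all fixed points `w` of `Y`. As `X`
is `α`-simple, these sets `X w X` span a dense ideal, so that `J` is dense in `X^α`. An ideal of
`(X ⊗ B(H_π))^{α ⊗ ad π}` is then dense since the products of its rows with rows of `X₂(π)` form a
non-zero ideal of `X^α`.
-/

noncomputable section

namespace FDyn

/-! ### Representations of compact groups -/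

section Representations

variable {G : Type*} [Group G] [TopologicalSpace G] (π : IrrRep G)

lemma mat_mul (g h : G) : π.mat (g * h) = π.mat g * π.mat h := by
  simp [IrrRep.mat]

@[fun_prop]
lemma continuous_mat (i j : Fin π.dim) : Continuous fun g => π.mat g i j :=
  (continuous_subtype_val.comp π.continuous_rep).matrix_elem i j

lemma mat_conjTranspose_mul (g : G) : (π.mat g)ᴴ * π.mat g = 1 := by
  rw [← mat_inv, mat_inv_mul]

lemma mat_mul_conjTranspose (g : G) : π.mat g * (π.mat g)ᴴ = 1 :=
  mul_eq_one_comm.1 (mat_conjTranspose_mul π g)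

lemma sum_star_mat_mul_mat (g : G) (k l : Fin π.dim) :
    ∑ m, star (π.mat g m k) * π.mat g m l = if k = l then 1 else 0 := by
  simpa [Matrix.mul_apply, Matrix.one_apply] using
    congrFun (congrFun (mat_conjTranspose_mul π g) k) l

lemma sum_mat_mul_star_mat (g : G) (k l : Fin π.dim) :
    ∑ m, π.mat g k m * star (π.mat g l m) = if k = l then 1 else 0 := by
  simpa [Matrix.mul_apply, Matrix.one_apply] using
    congrFun (congrFun (mat_mul_conjTranspose π g) k) l

lemma IrrRep.eq_smul_one_of_commute (M : Matrix (Fin π.dim) (Fin π.dim) ℂ)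
    (hM : ∀ g, M * π.mat g = π.mat g * M) : ∃ c : ℂ, M = c • (1 : Matrix _ _ ℂ) := by
  have : Nonempty (Fin π.dim) := ⟨⟨0, π.dim_pos⟩⟩
  obtain ⟨c, hc⟩ := Module.End.exists_eigenvalue (Matrix.toLin' M)
  have hinv : ∀ g, ∀ w ∈ Module.End.eigenspace (Matrix.toLin' M) c,
      π.mat g *ᵥ w ∈ Module.End.eigenspace (Matrix.toLin' M) c := fun g w hw => by
    rw [Module.End.mem_eigenspace_iff, toLin'_apply] at hw ⊢
    rw [mulVec_mulVec, hM, ← mulVec_mulVec, hw, mulVec_smul]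
  have htop := (π.irreducible _ hinv).resolve_left hc
  refine ⟨c, Matrix.toLin'.injective (LinearMap.ext fun v => ?_)⟩
  have hv : v ∈ Module.End.eigenspace (Matrix.toLin' M) c := htop ▸ Submodule.mem_top
  rw [Module.End.mem_eigenspace_iff.1 hv]
  simp

end Representations

section HaarMeasure

variable {G : Type*} [Group G] [TopologicalSpace G] [IsTopologicalGroup G] [CompactSpace G]
  [MeasurableSpace G] [BorelSpace G]

/-- The normalized Haar measure of a compact group. -/
abbrev haar (G : Type*) [Group G] [TopologicalSpace G] [IsTopologicalGroup G] [CompactSpace G]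
    [MeasurableSpace G] [BorelSpace G] : Measure G :=
  Measure.haarMeasure (⊤ : TopologicalSpace.PositiveCompacts G)

instance : IsProbabilityMeasure (haar G) :=
  ⟨by simpa using Measure.haarMeasure_self (K₀ := (⊤ : TopologicalSpace.PositiveCompacts G))⟩

lemma integrable_of_continuous {E : Type*} [NormedAddCommGroup E] {f : G → E}
    (hf : Continuous f) : Integrable f (haar G) :=
  hf.integrable_of_hasCompactSupport (HasCompactSupport.of_compactSpace f)

/-- The matrix `∫ π_g e_{lj} π_g* dg`, written entrywise. -/
def intertwiner (π : IrrRep G) (j l : Fin π.dim) : Matrix (Fin π.dim) (Fin π.dim) ℂ :=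
  of fun k i => ∫ g, star (π.mat g i j) * π.mat g k l ∂(haar G)

lemma intertwiner_commute (π : IrrRep G) (j l : Fin π.dim) (h : G) :
    intertwiner π j l * π.mat h = π.mat h * intertwiner π j l := by
  ext p s
  have hl : (intertwiner π j l * π.mat h) p s =
      ∫ g, star (π.mat (h⁻¹ * g) s j) * π.mat g p l ∂(haar G) := by
    simp only [intertwiner, Matrix.mul_apply, of_apply, mat_mul, mat_inv, conjTranspose_apply,
      star_sum, star_mul', star_star, Finset.sum_mul, ← integral_mul_const]
    rw [integral_finsetSum _ fun r _ => integrable_of_continuous (by fun_prop)]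
    exact Finset.sum_congr rfl fun r _ => integral_congr_ae (.of_forall fun g => by ring)
  have hr : (π.mat h * intertwiner π j l) p s =
      ∫ g, star (π.mat g s j) * π.mat (h * g) p l ∂(haar G) := by
    simp only [intertwiner, Matrix.mul_apply, of_apply, mat_mul, Finset.mul_sum,
      ← integral_const_mul]
    rw [integral_finsetSum _ fun r _ => integrable_of_continuous (by fun_prop)]
    exact Finset.sum_congr rfl fun r _ => integral_congr_ae (.of_forall fun g => by ring)
  rw [hl, hr, ← integral_mul_left_eq_self _ h]
  simp only [inv_mul_cancel_left]

lemma trace_intertwiner (π : IrrRep G) (j l : Fin π.dim) :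
    (intertwiner π j l).trace = if j = l then 1 else 0 := by
  simp only [intertwiner, Matrix.trace, diag_apply, of_apply]
  rw [← integral_finsetSum _ fun r _ => integrable_of_continuous (by fun_prop)]
  simp only [sum_star_mat_mul_mat, integral_const, probReal_univ, one_smul]

lemma integral_star_mat_mul_mat (π : IrrRep G) (i j k l : Fin π.dim) :
    (π.dim : ℂ) * ∫ g, star (π.mat g i j) * π.mat g k l ∂(haar G) =
      if i = k ∧ j = l then 1 else 0 := by
  obtain ⟨c, hc⟩ := π.eq_smul_one_of_commute _ (intertwiner_commute π j l)
  have hdim : (π.dim : ℂ) * c = if j = l then 1 else 0 := by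
    rw [← trace_intertwiner, hc]
    simp [mul_comm]
  have hentry : ∫ g, star (π.mat g i j) * π.mat g k l ∂(haar G) = c * if i = k then 1 else 0 := by
    simpa [intertwiner, Matrix.one_apply, eq_comm] using congrFun (congrFun hc k) i
  rw [hentry, ← mul_assoc, hdim]
  split_ifs <;> simp_all

end HaarMeasure

/-! ### The Peter–Weyl theorem -/

section IntegralOperators

open scoped InnerProductSpace

variable {S H 𝕜 : Type*} [TopologicalSpace S] [CompactSpace S] [RCLike 𝕜] [NormedAddCommGroup H]
  [InnerProductSpace 𝕜 H]

/-- The operator `f ↦ (x ↦ ⟪K x, f⟫)` from a Hilbert space to continuous functions with kernel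
`K`. For `H = L²` this is the integral operator with kernel `(x, y) ↦ conj (K x y)`. -/
def kernelOperator (K : C(S, H)) : H →L[𝕜] C(S, 𝕜) :=
  LinearMap.mkContinuous
    { toFun := fun f => ⟨fun x => ⟪K x, f⟫_𝕜, by fun_prop⟩
      map_add' := fun f g => by ext x; simp [inner_add_right]
      map_smul' := fun c f => by ext x; simp [inner_smul_right] } ‖K‖ fun f => by
    refine (ContinuousMap.norm_le _ (by positivity)).2 fun x => (norm_inner_le_norm _ _).trans ?_
    gcongr
    exact K.norm_coe_le_norm x

lemma kernelOperator_apply (K : C(S, H)) (f : H) (x : S) :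
    (kernelOperator K f : C(S, 𝕜)) x = ⟪K x, f⟫_𝕜 := rfl

lemma isCompactOperator_kernelOperator (K : C(S, H)) :
    IsCompactOperator (kernelOperator K : H →L[𝕜] C(S, 𝕜)) := by
  let T : H →L[𝕜] C(S, 𝕜) := kernelOperator K
  let L := ContinuousMap.linearIsometryBoundedOfCompact S 𝕜 𝕜
  suffices h : IsCompactOperator (L.toLinearEquiv.toLinearMap ∘ₗ T.toLinearMap) by
    simpa [Function.comp_def, T] using h.continuous_comp L.symm.continuous
  refine (isCompactOperator_iff_isCompact_closure_image_ball (𝕜₁ := 𝕜) _ (r := 1) one_pos).2 <|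
    BoundedContinuousFunction.arzela_ascoli (Metric.closedBall 0 ‖T‖)
      (isCompact_closedBall _ _) _ ?_ fun x => ?_
  · rintro _ x ⟨f, hf, rfl⟩
    simp only [Metric.mem_ball, dist_zero_right, Metric.mem_closedBall] at hf ⊢
    calc ‖T f x‖ ≤ ‖T f‖ := (T f).norm_coe_le_norm x
      _ ≤ ‖T‖ * ‖f‖ := T.le_opNorm f
      _ ≤ ‖T‖ := mul_le_of_le_one_right (norm_nonneg _) hf.le
  · rw [Metric.equicontinuousAt_iff_right]
    intro ε hε
    filter_upwards [Metric.tendsto_nhds.1 (K.continuous.continuousAt (x := x)) ε hε] with y hy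
    rintro ⟨_, f, hf, rfl⟩
    rw [Metric.mem_ball, dist_zero_right] at hf
    calc dist (⟪K x, f⟫_𝕜) (⟪K y, f⟫_𝕜) = ‖⟪K x - K y, f⟫_𝕜‖ := by
          rw [dist_eq_norm, inner_sub_left]
      _ ≤ ‖K x - K y‖ * ‖f‖ := norm_inner_le_norm _ _
      _ ≤ dist (K y) (K x) := by
          rw [dist_comm, dist_eq_norm]
          exact mul_le_of_le_one_right (norm_nonneg _) hf.le
      _ < ε := hy

end IntegralOperators

section Translation

open scoped InnerProductSpace

section

variable {G : Type*} [Group G] [TopologicalSpace G] [IsTopologicalGroup G]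

/-- Left translation `f ↦ f (h⁻¹ ·)` of continuous functions. -/
def translate (h : G) : C(G, ℂ) →ₗ[ℂ] C(G, ℂ) where
  toFun f := ⟨fun x => f (h⁻¹ * x), by fun_prop⟩
  map_add' _ _ := rfl
  map_smul' _ _ := rfl

@[simp] lemma translate_apply (h : G) (f : C(G, ℂ)) (x : G) : translate h f x = f (h⁻¹ * x) := rfl

lemma translate_mul (g h : G) (f : C(G, ℂ)) :
    translate (g * h) f = translate g (translate h f) := by
  ext x
  simp [mul_assoc]

lemma continuous_translate (f : C(G, ℂ)) : Continuous fun h : G => translate h f :=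
  (ContinuousMap.curry ⟨fun p : G × G => f (p.1⁻¹ * p.2), by fun_prop⟩).continuous

/-- `W` is globally invariant under left translations. -/
def IsTranslationInvariant (W : Submodule ℂ C(G, ℂ)) : Prop := ∀ h, ∀ f ∈ W, translate h f ∈ W

end

variable {G : Type*} [Group G] [TopologicalSpace G] [IsTopologicalGroup G] [CompactSpace G]
  [MeasurableSpace G] [BorelSpace G]

/-- The Hilbert space `L²(G)`. -/
abbrev LTwo (G : Type*) [Group G] [TopologicalSpace G] [IsTopologicalGroup G] [CompactSpace G]
    [MeasurableSpace G] [BorelSpace G] := Lp ℂ 2 (haar G)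

/-- The embedding of the continuous functions in `L²(G)`. -/
def toLTwo : C(G, ℂ) →L[ℂ] LTwo G := ContinuousMap.toLp 2 (haar G) ℂ

lemma inner_toLTwo (u v : C(G, ℂ)) :
    ⟪toLTwo u, toLTwo v⟫_ℂ = ∫ y, star (u y) * v y ∂(haar G) := by
  rw [L2.inner_def]
  refine integral_congr_ae ?_
  filter_upwards [ContinuousMap.coeFn_toLp (p := 2) (𝕜 := ℂ) (haar G) u,
    ContinuousMap.coeFn_toLp (p := 2) (𝕜 := ℂ) (haar G) v] with y hu hv
  simp only [toLTwo, hu, hv, RCLike.inner_apply]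
  exact mul_comm _ _

lemma toLTwo_injective : Function.Injective (toLTwo : C(G, ℂ) →L[ℂ] LTwo G) :=
  ContinuousMap.toLp_injective (p := 2) (𝕜 := ℂ) (haar G)

lemma denseRange_toLTwo : DenseRange (toLTwo : C(G, ℂ) →L[ℂ] LTwo G) :=
  ContinuousMap.toLp_denseRange ℂ (haar G) ℂ (by simp)

lemma inner_translate (h : G) (u v : C(G, ℂ)) :
    ⟪toLTwo (translate h u), toLTwo (translate h v)⟫_ℂ = ⟪toLTwo u, toLTwo v⟫_ℂ := by
  simp only [inner_toLTwo, translate_apply]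
  exact integral_mul_left_eq_self (fun y => star (u y) * v y) h⁻¹

lemma exists_orthonormal_basis (W : Submodule ℂ C(G, ℂ)) [FiniteDimensional ℂ W] :
    ∃ (n : ℕ) (w : Fin n → C(G, ℂ)),
      Orthonormal ℂ (fun i => toLTwo (w i)) ∧ Submodule.span ℂ (Set.range w) = W := by
  let T : C(G, ℂ) →ₗ[ℂ] LTwo G := (toLTwo : C(G, ℂ) →L[ℂ] LTwo G).toLinearMap
  let b := stdOrthonormalBasis ℂ (W.map T)
  choose w _ hwb using fun i => (b i).2
  have hspan : (Submodule.span ℂ (Set.range w)).map T = W.map T := by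
    have hrange : T '' Set.range w = Set.range ((W.map T).subtype ∘ b) := by
      rw [← Set.range_comp]
      exact congrArg Set.range (funext hwb)
    rw [Submodule.map_span, hrange, Set.range_comp, ← Submodule.map_span]
    rw [← b.coe_toBasis, b.toBasis.span_eq, Submodule.map_top, Submodule.range_subtype]
  refine ⟨_, w, ?_, Submodule.map_injective_of_injective toLTwo_injective hspan⟩
  have := b.orthonormal.comp_linearIsometry (Submodule.subtypeₗᵢ _)
  exact (funext hwb : (fun i => toLTwo (w i)) = _) ▸ this

/-- The matrix of the translation by `h` with respect to a family `w` that is orthonormal in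
`L²(G)`. -/
def translateMat {n : ℕ} (w : Fin n → C(G, ℂ)) (h : G) : Matrix (Fin n) (Fin n) ℂ :=
  of fun k l => ⟪toLTwo (w k), toLTwo (translate h (w l))⟫_ℂ

variable {n : ℕ} {w : Fin n → C(G, ℂ)}

lemma continuous_translateMat : Continuous (translateMat w) :=
  continuous_matrix fun _ l =>
    continuous_const.inner (toLTwo.continuous.comp (continuous_translate (w l)))

lemma translateMat_one (hon : Orthonormal ℂ (fun i => toLTwo (w i))) : translateMat w 1 = 1 := by
  ext k l
  have hone : translate 1 (w l) = w l := by ext; simp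
  rw [translateMat, of_apply, hone, orthonormal_iff_ite.1 hon k l, Matrix.one_apply]

lemma linearCombination_injective (hon : Orthonormal ℂ (fun i => toLTwo (w i))) :
    Function.Injective (Fintype.linearCombination ℂ w) :=
  (LinearIndependent.of_comp (toLTwo : C(G, ℂ) →L[ℂ] LTwo G).toLinearMap
    hon.linearIndependent).fintypeLinearCombination_injective

lemma translate_eq_sum (hon : Orthonormal ℂ (fun i => toLTwo (w i)))
    (hinv : IsTranslationInvariant (Submodule.span ℂ (Set.range w))) (h : G) (i : Fin n) :
    translate h (w i) = ∑ k, translateMat w h k i • w k := by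
  obtain ⟨c, hc⟩ := (Submodule.mem_span_range_iff_exists_fun ℂ).1
    (hinv h (w i) (Submodule.subset_span ⟨i, rfl⟩))
  have hcoeff : ∀ k, translateMat w h k i = c k := fun k => by
    rw [translateMat, of_apply, ← hc, map_sum]
    simp only [map_smul]
    exact hon.inner_right_fintype c k
  simp only [hcoeff, hc]

lemma linearCombination_translateMat_mulVec (hon : Orthonormal ℂ (fun i => toLTwo (w i)))
    (hinv : IsTranslationInvariant (Submodule.span ℂ (Set.range w))) (h : G) (v : Fin n → ℂ) :
    Fintype.linearCombination ℂ w (translateMat w h *ᵥ v) =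
      translate h (Fintype.linearCombination ℂ w v) := by
  simp only [Fintype.linearCombination_apply, map_sum, map_smul, Matrix.mulVec, dotProduct,
    translate_eq_sum hon hinv, Finset.smul_sum, Finset.sum_smul, smul_smul]
  rw [Finset.sum_comm]
  simp only [mul_comm]

lemma translateMat_mul (hon : Orthonormal ℂ (fun i => toLTwo (w i)))
    (hinv : IsTranslationInvariant (Submodule.span ℂ (Set.range w))) (g h : G) :
    translateMat w (g * h) = translateMat w g * translateMat w h := by
  refine Matrix.ext_of_mulVec_single fun l => linearCombination_injective hon ?_
  simp only [← Matrix.mulVec_mulVec, linearCombination_translateMat_mulVec hon hinv,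
    translate_mul]

lemma translateMat_mem_unitaryGroup (hon : Orthonormal ℂ (fun i => toLTwo (w i)))
    (hinv : IsTranslationInvariant (Submodule.span ℂ (Set.range w))) (h : G) :
    translateMat w h ∈ unitaryGroup (Fin n) ℂ := by
  rw [mem_unitaryGroup_iff']
  ext k l
  have horth : ⟪toLTwo (translate h (w k)), toLTwo (translate h (w l))⟫_ℂ =
      if k = l then 1 else 0 :=
    (inner_translate h _ _).trans (orthonormal_iff_ite.1 hon k l)
  rw [translate_eq_sum hon hinv, translate_eq_sum hon hinv, map_sum, map_sum] at horth
  simp only [map_smul] at horth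
  rw [hon.inner_sum] at horth
  simpa [Matrix.mul_apply, star_eq_conjTranspose, conjTranspose_apply, Matrix.one_apply]
    using horth

lemma exists_irrRep_of_minimal {W : Submodule ℂ C(G, ℂ)} [FiniteDimensional ℂ W]
    (hW : Minimal (fun W => W ≠ ⊥ ∧ IsTranslationInvariant W) W) :
    ∃ (π : IrrRep G) (w : Fin π.dim → C(G, ℂ)), (∀ i, w i ∈ W) ∧ (∀ i, w i ≠ 0) ∧
      ∀ h i, translate h (w i) = ∑ k, π.mat h k i • w k := by
  obtain ⟨n, w, hon, rfl⟩ := exists_orthonormal_basis W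
  have hne := hW.prop.1
  have hinv := hW.prop.2
  have hn : 0 < n := Nat.pos_of_ne_zero fun h => by subst h; simp at hne
  let c : (Fin n → ℂ) →ₗ[ℂ] C(G, ℂ) := Fintype.linearCombination ℂ w
  have hrange : LinearMap.range c = Submodule.span ℂ (Set.range w) :=
    Fintype.range_linearCombination ℂ w
  have hirr (U : Submodule ℂ (Fin n → ℂ)) (hU : ∀ g, ∀ v ∈ U, translateMat w g *ᵥ v ∈ U) :
      U = ⊥ ∨ U = ⊤ := by
    refine or_iff_not_imp_left.2 fun hU0 => ?_
    have hcU : IsTranslationInvariant (U.map c) := by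
      rintro h _ ⟨v, hv, rfl⟩
      exact ⟨_, hU h v hv, linearCombination_translateMat_mulVec hon hinv h v⟩
    have hinj := linearCombination_injective hon
    refine Submodule.map_injective_of_injective hinj <| le_antisymm (Submodule.map_mono le_top) ?_
    rw [Submodule.map_top, hrange]
    exact hW.le_of_le ⟨fun h => hU0 (Submodule.map_injective_of_injective hinj (by simpa using h)),
      hcU⟩ (hrange ▸ LinearMap.map_le_range)
  exact ⟨⟨n, hn, ⟨⟨fun h => ⟨translateMat w h, translateMat_mem_unitaryGroup hon hinv h⟩,
      Subtype.ext (translateMat_one hon)⟩, fun g h => Subtype.ext (translateMat_mul hon hinv g h)⟩,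
      continuous_translateMat.subtype_mk _, hirr⟩, w, fun i => Submodule.subset_span ⟨i, rfl⟩,
    fun i hi => by simpa [hi] using hon.1 i, translate_eq_sum hon hinv⟩

end Translation

section PeterWeyl

open scoped InnerProductSpace

variable {G : Type*} [Group G] [TopologicalSpace G]

/-- The complex conjugate of a matrix coefficient. -/
def conjCoeff (π : IrrRep G) (i j : Fin π.dim) : C(G, ℂ) where
  toFun g := star (π.mat g i j)
  continuous_toFun := (continuous_mat π i j).star

/-- The span of the conjugates of the matrix coefficients of the fixed representatives. -/
def coeffSpan (G : Type*) [Group G] [TopologicalSpace G] : Submodule ℂ C(G, ℂ) :=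
  Submodule.span ℂ {f | ∃ (c : DualSet G) (i j : Fin c.rep.dim), f = conjCoeff c.rep i j}

lemma conjCoeff_mem_coeffSpan (π : IrrRep G) (i j : Fin π.dim) : conjCoeff π i j ∈ coeffSpan G := by
  let c : DualSet G := Quotient.mk _ π
  obtain ⟨U, hU, -, hUπ⟩ : IrrRep.UnitarilyEquiv π c.rep :=
    Setoid.symm (Quotient.exact (Quotient.out_eq c))
  have hπ (g : G) : π.mat g = Uᴴ * c.rep.mat g * U := by
    rw [Matrix.mul_assoc, ← hUπ, ← Matrix.mul_assoc, hU, Matrix.one_mul]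
  have hsum : conjCoeff π i j =
      ∑ l, ∑ k, star (Uᴴ i k * U l j) • conjCoeff c.rep k l := by
    ext g
    simp only [conjCoeff, ContinuousMap.coe_mk, hπ, Matrix.mul_apply, star_sum, star_mul',
      ContinuousMap.coe_sum, Finset.sum_apply, ContinuousMap.coe_smul, Pi.smul_apply, smul_eq_mul,
      Finset.sum_mul]
    exact Finset.sum_congr rfl fun l _ => Finset.sum_congr rfl fun k _ => by ring
  rw [hsum]
  exact sum_mem fun l _ => sum_mem fun k _ =>
    Submodule.smul_mem _ _ (Submodule.subset_span ⟨c, k, l, rfl⟩)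

variable [IsTopologicalGroup G]

lemma isTranslationInvariant_coeffSpan : IsTranslationInvariant (coeffSpan G) := by
  intro h
  refine (Submodule.span_le (p := (coeffSpan G).comap (translate h))).2 ?_
  rintro _ ⟨c, i, j, rfl⟩
  have hsum : translate h (conjCoeff c.rep i j) =
      ∑ l, star (c.rep.mat h⁻¹ i l) • conjCoeff c.rep l j := by
    ext x
    simp [conjCoeff, mat_mul, Matrix.mul_apply]
  rw [SetLike.mem_coe, Submodule.mem_comap, hsum]
  exact sum_mem fun l _ => Submodule.smul_mem _ _ (conjCoeff_mem_coeffSpan _ l j)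

variable [CompactSpace G] [MeasurableSpace G] [BorelSpace G]

lemma exists_mem_coeffSpan_of_isTranslationInvariant {E : Submodule ℂ C(G, ℂ)}
    [FiniteDimensional ℂ E] (hne : E ≠ ⊥) (hE : IsTranslationInvariant E) :
    ∃ f ∈ E, f ≠ 0 ∧ f ∈ coeffSpan G := by
  have : WellFoundedLT (Set.Iic E) := (Submodule.mapIic E).symm.toOrderEmbedding.wellFoundedLT
  obtain ⟨⟨W, hWE⟩, ⟨hW, hWinv⟩, hmin⟩ := exists_minimal_of_wellFoundedLT
    (fun W : Set.Iic E => W.1 ≠ ⊥ ∧ IsTranslationInvariant W.1) ⟨⟨E, Set.mem_Iic.2 le_rfl⟩, hne, hE⟩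
  have := Submodule.finiteDimensional_of_le hWE
  obtain ⟨π, w, hwW, hw0, hw⟩ := exists_irrRep_of_minimal (W := W)
    ⟨⟨hW, hWinv⟩, fun V hV hVW => hmin (y := ⟨V, hVW.trans hWE⟩) hV hVW⟩
  let i : Fin π.dim := ⟨0, π.dim_pos⟩
  have hwi : w i = ∑ l, w l 1 • conjCoeff π i l := by
    ext h
    simpa [conjCoeff, mat_inv, mul_comm] using congrArg (fun f : C(G, ℂ) => f 1) (hw h⁻¹ i)
  refine ⟨w i, hWE (hwW i), hw0 i, ?_⟩
  rw [hwi]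
  exact sum_mem fun l _ => Submodule.smul_mem _ _ (conjCoeff_mem_coeffSpan π i l)

/-- The operator `u ↦ (x ↦ ∫ k (x⁻¹ y) u y dy)` from `L²(G)` to the continuous functions. -/
def convToCont (k : C(G, ℂ)) : LTwo G →L[ℂ] C(G, ℂ) :=
  kernelOperator ((⟨toLTwo, toLTwo.continuous⟩ : C(C(G, ℂ), LTwo G)).comp
    ⟨fun x => translate x (star k), continuous_translate _⟩)

/-- The same operator, followed by the embedding of the continuous functions in `L²(G)`. -/
def convLTwo (k : C(G, ℂ)) : LTwo G →L[ℂ] LTwo G := toLTwo ∘L convToCont k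

lemma isCompactOperator_convLTwo (k : C(G, ℂ)) : IsCompactOperator (convLTwo k) :=
  (isCompactOperator_kernelOperator _).clm_comp toLTwo

lemma convToCont_toLTwo (k u : C(G, ℂ)) (x : G) :
    convToCont k (toLTwo u) x = ∫ y, k (x⁻¹ * y) * u y ∂(haar G) := by
  rw [convToCont, kernelOperator_apply]
  exact (inner_toLTwo _ _).trans (by simp)

lemma convToCont_translate (k f : C(G, ℂ)) (h : G) :
    convToCont k (toLTwo (translate h f)) = translate h (convToCont k (toLTwo f)) := by
  ext x
  simp only [convToCont_toLTwo, translate_apply]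
  rw [← integral_mul_left_eq_self _ h]
  simp [mul_assoc]

lemma convToCont_mem_coeffSpan (k : C(G, ℂ)) {f : C(G, ℂ)} (hf : f ∈ coeffSpan G) :
    convToCont k (toLTwo f) ∈ coeffSpan G := by
  refine (Submodule.span_le (p := (coeffSpan G).comap
    (convToCont k ∘L toLTwo : C(G, ℂ) →L[ℂ] C(G, ℂ)).toLinearMap)).2 ?_ hf
  rintro _ ⟨c, i, j, rfl⟩
  have hsum : convToCont k (toLTwo (conjCoeff c.rep i j)) =
      ∑ l, (∫ y, k y * star (c.rep.mat y l j) ∂(haar G)) • conjCoeff c.rep i l := by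
    ext x
    rw [convToCont_toLTwo, ← integral_mul_left_eq_self _ x]
    simp only [conjCoeff, ContinuousMap.coe_mk, inv_mul_cancel_left, mat_mul, Matrix.mul_apply,
      ContinuousMap.coe_sum, Finset.sum_apply, ContinuousMap.coe_smul, Pi.smul_apply, smul_eq_mul,
      star_sum, star_mul', Finset.mul_sum, ← integral_mul_const]
    rw [integral_finsetSum _ fun l _ => integrable_of_continuous (by fun_prop)]
    exact Finset.sum_congr rfl fun l _ => integral_congr_ae (.of_forall fun y => by ring)
  refine Submodule.mem_comap.2 (hsum ▸ ?_)
  exact sum_mem fun l _ => Submodule.smul_mem _ _ (conjCoeff_mem_coeffSpan _ i l)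

/-- The kernel `(x, y) ↦ k (x⁻¹ y)` is hermitian. -/
def IsHermitianKernel (k : C(G, ℂ)) : Prop := ∀ g, star (k g) = k g⁻¹

lemma IsHermitianKernel.isSymmetric {k : C(G, ℂ)} (hk : IsHermitianKernel k) :
    (convLTwo k : LTwo G →ₗ[ℂ] LTwo G).IsSymmetric := by
  intro f h
  refine denseRange_toLTwo.induction_on₂
    (p := fun f h => ⟪convLTwo k f, h⟫_ℂ = ⟪f, convLTwo k h⟫_ℂ)
    (isClosed_eq (by fun_prop) (by fun_prop)) (fun u v => ?_) f h
  simp only [convLTwo, ContinuousLinearMap.comp_apply, inner_toLTwo, convToCont_toLTwo,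
    ← integral_const_mul]
  have hstar (x : G) : star (∫ y, k (x⁻¹ * y) * u y ∂(haar G)) * v x =
      ∫ y, star (u y) * (k (y⁻¹ * x) * v x) ∂(haar G) := by
    rw [RCLike.star_def, ← integral_conj, ← integral_mul_const]
    refine integral_congr_ae (.of_forall fun y => ?_)
    have hkxy : star (k (x⁻¹ * y)) = k (y⁻¹ * x) := by simpa using hk (x⁻¹ * y)
    simp only [map_mul, ← RCLike.star_def, hkxy]
    ring
  simp only [hstar]
  exact integral_integral_swap_of_hasCompactSupport
    (f := fun x y => star (u y) * (k (y⁻¹ * x) * v x)) (by fun_prop)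
    (HasCompactSupport.of_compactSpace _)

/-- The orthogonal complement of the matrix coefficients in `L²(G)`. -/
def coeffOrth (G : Type*) [Group G] [TopologicalSpace G] [IsTopologicalGroup G] [CompactSpace G]
    [MeasurableSpace G] [BorelSpace G] : Submodule ℂ (LTwo G) :=
  ((coeffSpan G).map (toLTwo : C(G, ℂ) →L[ℂ] LTwo G).toLinearMap)ᗮ

instance : CompleteSpace (coeffOrth G) :=
  (Submodule.isClosed_orthogonal _).completeSpace_coe

lemma mem_coeffOrth {f : LTwo G} : f ∈ coeffOrth G ↔ ∀ u ∈ coeffSpan G, ⟪toLTwo u, f⟫_ℂ = 0 := by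
  simp [coeffOrth, Submodule.mem_orthogonal]

lemma translate_mem_coeffOrth (h : G) {f : C(G, ℂ)} (hf : toLTwo f ∈ coeffOrth G) :
    toLTwo (translate h f) ∈ coeffOrth G := by
  refine mem_coeffOrth.2 fun u hu => ?_
  have hu' : translate h (translate h⁻¹ u) = u := by ext; simp
  rw [← hu', inner_translate]
  exact mem_coeffOrth.1 hf _ (isTranslationInvariant_coeffSpan _ u hu)

lemma IsHermitianKernel.convLTwo_mem_coeffOrth {k : C(G, ℂ)} (hk : IsHermitianKernel k) {f : LTwo G}
    (hf : f ∈ coeffOrth G) : convLTwo k f ∈ coeffOrth G := by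
  refine mem_coeffOrth.2 fun u hu => ?_
  exact (hk.isSymmetric (toLTwo u) f).symm.trans
    (mem_coeffOrth.1 hf _ (convToCont_mem_coeffSpan k hu))

/-- An eigenfunction orthogonal to the coefficients would generate a finite-dimensional translation
invariant space of such functions, but every such space contains a coefficient. -/
lemma eq_zero_of_convLTwo_eq_smul {k : C(G, ℂ)} {c : ℂ} (hc : c ≠ 0) {v : LTwo G}
    (hv : v ∈ coeffOrth G) (hkv : convLTwo k v = c • v) : v = 0 := by
  let E : Submodule ℂ C(G, ℂ) := (Module.End.eigenspace (convLTwo k).toLinearMap c ⊓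
    coeffOrth G).comap (toLTwo : C(G, ℂ) →L[ℂ] LTwo G).toLinearMap
  have hmemE (f : C(G, ℂ)) :
      f ∈ E ↔ convToCont k (toLTwo f) = c • f ∧ toLTwo f ∈ coeffOrth G := by
    simp only [E, Submodule.mem_comap, Submodule.mem_inf, Module.End.mem_eigenspace_iff]
    refine and_congr_left fun _ => ?_
    rw [← toLTwo_injective.eq_iff, map_smul]
    rfl
  have := ContinuousLinearMap.finite_dimensional_eigenspace (isCompactOperator_convLTwo k) c hc
  have : FiniteDimensional ℂ E := Module.Finite.of_injective
    ((toLTwo : C(G, ℂ) →L[ℂ] LTwo G).toLinearMap.restrict fun f (hf : f ∈ E) => hf.1)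
    fun f g hfg => Subtype.ext (toLTwo_injective (congrArg Subtype.val hfg))
  have hEinv : IsTranslationInvariant E := fun h f hf => by
    rw [hmemE] at hf ⊢
    exact ⟨by rw [convToCont_translate, hf.1, map_smul], translate_mem_coeffOrth h hf.2⟩
  have hE : E = ⊥ := by
    by_contra hne
    obtain ⟨f, hfE, hf0, hf⟩ := exists_mem_coeffSpan_of_isTranslationInvariant hne hEinv
    exact hf0 (toLTwo_injective
      (by rw [inner_self_eq_zero.1 (mem_coeffOrth.1 ((hmemE f).1 hfE).2 f hf), map_zero]))
  have hkv' : toLTwo (convToCont k v) = c • v := hkv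
  have hkE : convToCont k v ∈ E := by
    rw [hmemE, hkv', map_smul]
    exact ⟨rfl, Submodule.smul_mem _ c hv⟩
  rw [hE, Submodule.mem_bot] at hkE
  rw [hkE, map_zero] at hkv'
  exact (smul_eq_zero_iff_right hc).1 hkv'.symm

lemma IsHermitianKernel.convLTwo_eq_zero {k : C(G, ℂ)} (hk : IsHermitianKernel k) {f : LTwo G}
    (hf : f ∈ coeffOrth G) : convLTwo k f = 0 := by
  have hinv : ∀ f ∈ coeffOrth G, (convLTwo k).toLinearMap f ∈ coeffOrth G :=
    fun _ => hk.convLTwo_mem_coeffOrth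
  let T : coeffOrth G →L[ℂ] coeffOrth G := (convLTwo k).restrict hinv
  have hcompact : IsCompactOperator T := (isCompactOperator_convLTwo k).restrict' hinv
  have hsymm : T.IsSymmetric := hk.isSymmetric.restrict_invariant hinv
  suffices hT : T = 0 from congrArg Subtype.val (congrArg (fun S => S ⟨f, hf⟩) hT)
  rw [← ContinuousLinearMap.eq_zero_of_forall_hasEigenvalue_eq_zero hcompact hsymm]
  intro c hc
  obtain ⟨v, hv⟩ := hc.exists_hasEigenvector
  by_contra hc0
  exact hv.2 (Subtype.ext (eq_zero_of_convLTwo_eq_smul hc0 v.2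
    (congrArg Subtype.val hv.apply_eq_smul)))

/-- The weak form of the **Peter-Weyl theorem**. -/
lemma eq_zero_of_mem_coeffOrth {f : C(G, ℂ)} (hf : toLTwo f ∈ coeffOrth G) : f = 0 := by
  have hint {k : C(G, ℂ)} (hk : IsHermitianKernel k) : ∫ y, k y * f y ∂(haar G) = 0 := by
    have hzero : convToCont k (toLTwo f) = 0 :=
      toLTwo_injective ((hk.convLTwo_eq_zero hf).trans (map_zero _).symm)
    simpa [hzero] using (convToCont_toLTwo k f 1).symm
  -- `2 conj f = k₁ - i k₂` with hermitian kernels `k₁` and `k₂`.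
  let k₁ : C(G, ℂ) := ⟨fun g => star (f g) + f g⁻¹, by fun_prop⟩
  let k₂ : C(G, ℂ) := ⟨fun g => Complex.I * (star (f g) - f g⁻¹), by fun_prop⟩
  have h₁ := hint (k := k₁) fun g => by simp [k₁, add_comm]
  have h₂ := hint (k := k₂) fun g => by simp [k₂]; ring
  have hnorm : (2 : ℂ) * ⟪toLTwo f, toLTwo f⟫_ℂ = 0 := by
    calc (2 : ℂ) * ⟪toLTwo f, toLTwo f⟫_ℂ
        = ∫ y, (k₁ y * f y - Complex.I * (k₂ y * f y)) ∂(haar G) := by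
          rw [inner_toLTwo, ← integral_const_mul]
          refine integral_congr_ae (.of_forall fun y => ?_)
          simp only [k₁, k₂, ContinuousMap.coe_mk]
          linear_combination (star (f y) - f y⁻¹) * f y * Complex.I_mul_I
      _ = 0 := by
          rw [integral_sub (integrable_of_continuous (by fun_prop))
            (integrable_of_continuous (by fun_prop)), integral_const_mul, h₁, h₂, mul_zero,
            sub_zero]
  rw [mul_eq_zero_iff_left two_ne_zero, inner_self_eq_zero] at hnorm
  exact toLTwo_injective (hnorm.trans (map_zero _).symm)

lemma eq_zero_of_integral_star_mat_mul {f : G → ℂ} (hf : Continuous f)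
    (h : ∀ (c : DualSet G) (i j : Fin c.rep.dim),
      ∫ g, star (c.rep.mat g i j) * f g ∂(haar G) = 0) : f = 0 := by
  let u : C(G, ℂ) := ⟨fun g => star (f g), hf.star⟩
  suffices hu : toLTwo u ∈ coeffOrth G by
    funext g
    simpa [u] using congrArg (fun v : C(G, ℂ) => v g) (eq_zero_of_mem_coeffOrth hu)
  refine mem_coeffOrth.2 fun v hv => ?_
  induction hv using Submodule.span_induction with
  | mem v hv =>
    obtain ⟨c, i, j, rfl⟩ := hv
    rw [inner_toLTwo, ← star_eq_zero, RCLike.star_def, ← integral_conj, ← h c i j]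
    simp [conjCoeff, u]
  | zero => simp
  | add v w _ _ hv hw => rw [map_add, inner_add_left, hv, hw, add_zero]
  | smul c v _ hv => rw [map_smul, inner_smul_left, hv, mul_zero]

end PeterWeyl

/-! ### Weak closures -/

section WeakClosure

variable {V W U : Type*} [AddCommGroup V] [Module ℂ V] [AddCommGroup W] [Module ℂ W]
  [AddCommGroup U] [Module ℂ U]

/-- The closure of a subspace in the weak topology given by a space `D` of functionals, in the form
provided by the bipolar theorem. -/
def weakClosure (D : Submodule ℂ (Module.Dual ℂ V)) (S : Submodule ℂ V) : Submodule ℂ V :=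
  (D ⊓ S.dualAnnihilator).dualCoannihilator

lemma mem_weakClosure {D : Submodule ℂ (Module.Dual ℂ V)} {S : Submodule ℂ V} {v : V} :
    v ∈ weakClosure D S ↔ ∀ φ ∈ D, (∀ s ∈ S, φ s = 0) → φ v = 0 := by
  simp [weakClosure, Submodule.mem_dualCoannihilator, Submodule.mem_dualAnnihilator]

lemma le_weakClosure (D : Submodule ℂ (Module.Dual ℂ V)) (S : Submodule ℂ V) :
    S ≤ weakClosure D S :=
  fun _ hs => mem_weakClosure.2 fun _ _ h => h _ hs

lemma weakClosure_le_weakClosure {D : Submodule ℂ (Module.Dual ℂ V)} {S T : Submodule ℂ V}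
    (h : S ≤ weakClosure D T) : weakClosure D S ≤ weakClosure D T :=
  fun _ hv => mem_weakClosure.2 fun φ hφ hT =>
    mem_weakClosure.1 hv φ hφ fun _ hs => mem_weakClosure.1 (h hs) φ hφ hT

lemma weakClosure_weakClosure_le (D : Submodule ℂ (Module.Dual ℂ V)) (S : Submodule ℂ V) :
    weakClosure D (weakClosure D S) ≤ weakClosure D S := weakClosure_le_weakClosure le_rfl

lemma mem_weakClosure_of_tendsto [TopologicalSpace V] {D : Submodule ℂ (Module.Dual ℂ V)}
    (hD : ∀ φ ∈ D, Continuous φ) {S : Submodule ℂ V} {β : Type*} {l : Filter β} [l.NeBot]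
    {u : β → V} (hu : ∀ᶠ b in l, u b ∈ S) {v : V} (hv : Filter.Tendsto u l (𝓝 v)) :
    v ∈ weakClosure D S :=
  mem_weakClosure.2 fun φ hφ hS => (isClosed_eq (hD φ hφ) continuous_const).mem_of_tendsto hv
    (hu.mono fun _ => hS _)

lemma mem_span_iff_continuous_induced {ι : Type*} (f : ι → Module.Dual ℂ V)
    {φ : Module.Dual ℂ V} : φ ∈ Submodule.span ℂ (Set.range f) ↔
      Continuous[.induced (fun v i => f i v) inferInstance, inferInstance] φ := by
  rw [LinearMap.mem_span_iff_continuous, ← induced_to_pi]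

/-- A basic neighbourhood is given by finitely many functionals, and a point whose image in the
corresponding finite-dimensional space is not in that of `S` is separated from `S` by a linear form
on this space. -/
lemma closure_induced_eq_weakClosure {ι : Type*} (f : ι → Module.Dual ℂ V) (S : Submodule ℂ V) :
    closure[.induced (fun v i => f i v) inferInstance] (S : Set V) =
      weakClosure (Submodule.span ℂ (Set.range f)) S := by
  let _ : TopologicalSpace V := .induced (fun v i => f i v) inferInstance
  have hf (i : ι) : Continuous (f i) :=
    (mem_span_iff_continuous_induced f).1 (Submodule.subset_span ⟨i, rfl⟩)
  refine subset_antisymm (fun v hv => mem_weakClosure.2 fun φ hφ hS => ?_) fun v hv => ?_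
  · have hφc : Continuous φ := (mem_span_iff_continuous_induced f).1 hφ
    exact closure_minimal (t := {v | φ v = 0}) hS (isClosed_eq hφc continuous_const) hv
  · refine mem_closure_iff.2 fun o ho hvo => ?_
    obtain ⟨o', ho', rfl⟩ := isOpen_induced_iff.1 ho
    obtain ⟨I, u, hu, hIu⟩ := isOpen_pi_iff.1 ho' _ hvo
    let Φ : V →ₗ[ℂ] (I → ℂ) := LinearMap.pi fun i => f i
    have hΦ : Φ v ∈ S.map Φ := by
      by_contra hnot
      obtain ⟨l, hl, hker⟩ := Submodule.exists_le_ker_of_notMem hnot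
      have hΦc : Continuous Φ := continuous_pi fun i => hf i
      exact hl (mem_weakClosure.1 hv (l ∘ₗ Φ)
        ((mem_span_iff_continuous_induced f).2 (l.continuous_of_finiteDimensional.comp hΦc))
        fun s hs => hker (Submodule.mem_map_of_mem hs))
    obtain ⟨s, hs, hsv⟩ := hΦ
    refine ⟨s, hIu fun i hi => ?_, hs⟩
    have hi' : f i s = f i v := congrFun hsv ⟨i, hi⟩
    exact Set.mem_of_eq_of_mem hi' (hu i hi).2

/-- Continuity for the weak topologies given by the spaces `D` and `E` of functionals: the
functionals of `E` are pulled back to functionals of `D`. -/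
def WeaklyContinuous (D : Submodule ℂ (Module.Dual ℂ V)) (E : Submodule ℂ (Module.Dual ℂ W))
    (T : V → W) : Prop :=
  ∀ φ ∈ E, ∃ ψ ∈ D, ∀ v, ψ v = φ (T v)

variable {D : Submodule ℂ (Module.Dual ℂ V)} {E : Submodule ℂ (Module.Dual ℂ W)}
  {D' : Submodule ℂ (Module.Dual ℂ U)} {T : V → W}

namespace WeaklyContinuous

lemma map_mem_span (hT : WeaklyContinuous D E T) {A : Set V} {R : Submodule ℂ W}
    (h : ∀ s ∈ A, T s ∈ weakClosure E R) {v : V} (hv : v ∈ weakClosure D (Submodule.span ℂ A)) :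
    T v ∈ weakClosure E R := by
  refine mem_weakClosure.2 fun φ hφ hR => ?_
  obtain ⟨ψ, hψ, hψT⟩ := hT φ hφ
  rw [← hψT]
  refine mem_weakClosure.1 hv ψ hψ fun s hs => Submodule.span_le (p := LinearMap.ker ψ).2 ?_ hs
  exact fun s hs => (hψT s).trans (mem_weakClosure.1 (h s hs) φ hφ hR)

lemma map_mem (hT : WeaklyContinuous D E T) {S : Submodule ℂ V} {R : Submodule ℂ W}
    (h : ∀ s ∈ S, T s ∈ weakClosure E R) {v : V} (hv : v ∈ weakClosure D S) :
    T v ∈ weakClosure E R :=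
  hT.map_mem_span (A := S) h (by rwa [Submodule.span_eq])

lemma comp {T' : U → V} (hT : WeaklyContinuous D E T) (hT' : WeaklyContinuous D' D T') :
    WeaklyContinuous D' E (fun u => T (T' u)) := by
  intro φ hφ
  obtain ⟨ψ, hψ, hψT⟩ := hT φ hφ
  obtain ⟨χ, hχ, hχT⟩ := hT' ψ hψ
  exact ⟨χ, hχ, fun u => (hχT u).trans (hψT _)⟩

lemma sum {ι : Type*} {s : Finset ι} {T : ι → V → W}
    (h : ∀ i ∈ s, WeaklyContinuous D E (T i)) : WeaklyContinuous D E (fun v => ∑ i ∈ s, T i v) := by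
  intro φ hφ
  choose! ψ hψ hψT using fun i hi => h i hi φ hφ
  refine ⟨∑ i ∈ s, ψ i, sum_mem hψ, fun v => ?_⟩
  rw [map_sum, LinearMap.sum_apply]
  exact Finset.sum_congr rfl fun i hi => hψT i hi v

lemma smul (c : ℂ) (hT : WeaklyContinuous D E T) : WeaklyContinuous D E (fun v => c • T v) := by
  intro φ hφ
  obtain ⟨ψ, hψ, hψT⟩ := hT φ hφ
  exact ⟨c • ψ, Submodule.smul_mem _ _ hψ, fun v => by simp [hψT]⟩

lemma of_range {ι : Type*} {f : ι → Module.Dual ℂ W}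
    (h : ∀ i, ∃ ψ ∈ D, ∀ v, ψ v = f i (T v)) :
    WeaklyContinuous D (Submodule.span ℂ (Set.range f)) T := by
  intro φ hφ
  induction hφ using Submodule.span_induction with
  | mem φ hφ => obtain ⟨i, rfl⟩ := hφ; exact h i
  | zero => exact ⟨0, zero_mem _, fun _ => rfl⟩
  | add φ χ _ _ hφ hχ =>
    obtain ⟨ψ, hψ, hψφ⟩ := hφ
    obtain ⟨ω, hω, hωχ⟩ := hχ
    exact ⟨ψ + ω, add_mem hψ hω, fun v => by simp [hψφ, hωχ]⟩
  | smul c φ _ hφ =>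
    obtain ⟨ψ, hψ, hψφ⟩ := hφ
    exact ⟨c • ψ, Submodule.smul_mem _ _ hψ, fun v => by simp [hψφ]⟩

end WeaklyContinuous

end WeakClosure

section Functionals

variable {X : Type*} [NonUnitalCStarAlgebra X] {F : Submodule ℂ (StrongDual ℂ X)}

/-- The elements of `F` as linear functionals. -/
def xDual (F : Submodule ℂ (StrongDual ℂ X)) : Submodule ℂ (Module.Dual ℂ X) :=
  Submodule.span ℂ (Set.range fun φ : F => (φ.1 : X →ₗ[ℂ] ℂ))

/-- The elements of `F ⊗ B(ℂⁿ)*` as linear functionals. -/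
def matDual (F : Submodule ℂ (StrongDual ℂ X)) (n : ℕ) :
    Submodule ℂ (Module.Dual ℂ (Matrix (Fin n) (Fin n) X)) :=
  Submodule.span ℂ (Set.range fun p : Fin n × Fin n × F =>
    (p.2.2.1 : X →ₗ[ℂ] ℂ) ∘ₗ Matrix.entryLinearMap ℂ X p.1 p.2.1)

lemma mem_xDual {ψ : Module.Dual ℂ X} : ψ ∈ xDual F ↔ ∃ φ ∈ F, (φ : X →ₗ[ℂ] ℂ) = ψ := by
  have hrange : (Set.range fun φ : F => (φ.1 : X →ₗ[ℂ] ℂ)) =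
      F.map (ContinuousLinearMap.coeLM ℂ : StrongDual ℂ X →ₗ[ℂ] X →ₗ[ℂ] ℂ) := by
    ext; simp
  rw [xDual, hrange, Submodule.span_eq, Submodule.mem_map]
  rfl

lemma coe_mem_xDual {φ : StrongDual ℂ X} (hφ : φ ∈ F) : (φ : X →ₗ[ℂ] ℂ) ∈ xDual F :=
  mem_xDual.2 ⟨φ, hφ, rfl⟩

lemma mem_weakClosure_xDual {S : Submodule ℂ X} {x : X} :
    x ∈ weakClosure (xDual F) S ↔ ∀ φ ∈ F, (∀ s ∈ S, φ s = 0) → φ x = 0 := by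
  simp [mem_weakClosure, mem_xDual]

lemma weaklyContinuous_xDual_iff {T : X → X} : WeaklyContinuous (xDual F) (xDual F) T ↔
    ∀ φ ∈ F, ∃ ψ ∈ F, ∀ x, ψ x = φ (T x) := by
  simp [WeaklyContinuous, mem_xDual]

lemma closure_fTopology (S : Submodule ℂ X) :
    closure[fTopology F] (S : Set X) = weakClosure (xDual F) S :=
  closure_induced_eq_weakClosure (fun φ : F => (φ.1 : X →ₗ[ℂ] ℂ)) S

lemma closure_matTopology {n : ℕ} (S : Submodule ℂ (Matrix (Fin n) (Fin n) X)) :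
    closure[matTopology F n] (S : Set (Matrix (Fin n) (Fin n) X)) = weakClosure (matDual F n) S :=
  closure_induced_eq_weakClosure (fun p : Fin n × Fin n × F =>
    (p.2.2.1 : X →ₗ[ℂ] ℂ) ∘ₗ Matrix.entryLinearMap ℂ X p.1 p.2.1) S

lemma isClosed_fTopology_iff (S : Submodule ℂ X) :
    IsClosed[fTopology F] (S : Set X) ↔ weakClosure (xDual F) S ≤ S := by
  rw [← @closure_subset_iff_isClosed _ (fTopology F), closure_fTopology]
  rfl

lemma mem_xDual_iff_continuous {φ : Module.Dual ℂ X} :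
    φ ∈ xDual F ↔ Continuous[fTopology F, inferInstance] φ :=
  mem_span_iff_continuous_induced fun φ : F => (φ.1 : X →ₗ[ℂ] ℂ)

lemma weaklyContinuous_of_continuous (T : X →ₗ[ℂ] X)
    (hT : Continuous[fTopology F, fTopology F] T) : WeaklyContinuous (xDual F) (xDual F) T := by
  let _ := fTopology F
  exact fun φ hφ => ⟨φ ∘ₗ T,
    mem_xDual_iff_continuous.2 ((mem_xDual_iff_continuous.1 hφ).comp hT), fun _ => rfl⟩

lemma weaklyContinuous_entry {n : ℕ} (i j : Fin n) :
    WeaklyContinuous (matDual F n) (xDual F) (fun a : Matrix (Fin n) (Fin n) X => a i j) :=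
  WeaklyContinuous.of_range fun φ => ⟨_, Submodule.subset_span ⟨(i, j, φ), rfl⟩, fun _ => rfl⟩

lemma WeaklyContinuous.of_entries {V : Type*} [AddCommGroup V] [Module ℂ V]
    {D : Submodule ℂ (Module.Dual ℂ V)} {n : ℕ} {T : V → Matrix (Fin n) (Fin n) X}
    (h : ∀ i j, WeaklyContinuous D (xDual F) (fun v => T v i j)) :
    WeaklyContinuous D (matDual F n) T :=
  WeaklyContinuous.of_range fun p => h p.1 p.2.1 _ (coe_mem_xDual p.2.2.2)

lemma continuous_of_mem_xDual {φ : Module.Dual ℂ X} (hφ : φ ∈ xDual F) : Continuous φ := by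
  obtain ⟨φ, -, rfl⟩ := mem_xDual.1 hφ
  exact φ.continuous

lemma continuous_of_mem_matDual {n : ℕ} {φ : Module.Dual ℂ (Matrix (Fin n) (Fin n) X)}
    (hφ : φ ∈ matDual F n) : Continuous φ := by
  induction hφ using Submodule.span_induction with
  | mem φ hφ =>
    obtain ⟨p, rfl⟩ := hφ
    exact p.2.2.1.continuous.comp (continuous_id.matrix_elem p.1 p.2.1)
  | zero => exact continuous_const
  | add φ ψ _ _ hφ hψ => exact hφ.add hψ
  | smul c φ _ hφ => exact hφ.const_smul c

lemma isClosed_of_weakClosure_le {S : Submodule ℂ X} (h : weakClosure (xDual F) S ≤ S) :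
    IsClosed (S : Set X) := by
  refine isClosed_of_closure_subset fun x hx => h ?_
  have := mem_closure_iff_nhdsWithin_neBot.1 hx
  exact mem_weakClosure_of_tendsto (fun _ => continuous_of_mem_xDual)
    eventually_mem_nhdsWithin (tendsto_nhdsWithin_of_tendsto_nhds Filter.tendsto_id)

end Functionals

section ApproximateUnits

variable {X : Type*} [NonUnitalCStarAlgebra X] [PartialOrder X] [StarOrderedRing X]

lemma norm_sub_mul_sq_le {u a s : X} (hu : IsSelfAdjoint u) (h : a * star a ≤ s) :
    ‖a - u * a‖ ^ 2 ≤ ‖s - u * s - (s - u * s) * u‖ := by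
  obtain ⟨c, hc⟩ := CStarAlgebra.nonneg_iff_eq_mul_star_self.1 (sub_nonneg.2 h)
  have hmul (b : X) : (b - u * b) * star (b - u * b) =
      b * star b - u * (b * star b) - (b * star b - u * (b * star b)) * u := by
    rw [star_sub, star_mul, hu.star_eq]
    noncomm_ring
  have hsum : s - u * s - (s - u * s) * u =
      (a - u * a) * star (a - u * a) + (c - u * c) * star (c - u * c) := by
    rw [hmul, hmul, ← hc]
    noncomm_ring
  rw [sq, ← CStarRing.norm_self_mul_star, hsum]
  exact CStarAlgebra.norm_le_norm_of_nonneg_of_le (mul_star_self_nonneg _)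
    (le_add_of_nonneg_right (mul_star_self_nonneg _))

lemma exists_approximateUnit (S : NonUnitalStarSubalgebra ℂ X) (hS : IsClosed (S : Set X)) :
    ∃ l : Filter X, l.NeBot ∧ (∀ᶠ u in l, u ∈ S) ∧
      ∀ s ∈ S, ∀ a, a * star a ≤ s → Filter.Tendsto (fun u => u * a) l (𝓝 a) := by
  have : IsClosed (S : Set X) := hS
  let _ : NonUnitalCStarAlgebra S := NonUnitalStarSubalgebra.nonUnitalCStarAlgebra S
  let _ : PartialOrder S := CStarAlgebra.spectralOrder S
  have : StarOrderedRing S := CStarAlgebra.spectralOrderedRing S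
  have hl := CStarAlgebra.increasingApproximateUnit S
  refine ⟨(CStarAlgebra.approximateUnit S).map (↑), inferInstance,
    Filter.eventually_map.2 (.of_forall fun u => u.2), fun s hs a ha => ?_⟩
  rw [Filter.tendsto_map'_iff, tendsto_iff_norm_sub_tendsto_zero]
  have hsu : Filter.Tendsto (fun u : S => ‖s - u * s‖) (CStarAlgebra.approximateUnit S) (𝓝 0) := by
    have hlim := ((tendsto_const_nhds (x := (⟨s, hs⟩ : S))).sub
      (hl.tendsto_mul_right ⟨s, hs⟩)).norm
    simpa using hlim
  have hsqrt := (Real.continuous_sqrt.tendsto _).comp (hsu.mul_const 2)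
  rw [zero_mul, Real.sqrt_zero] at hsqrt
  refine squeeze_zero' (.of_forall fun _ => norm_nonneg _) ?_ hsqrt
  filter_upwards [hl.eventually_norm, hl.eventually_isSelfAdjoint] with u hu husa
  rw [norm_sub_rev]
  refine Real.le_sqrt_of_sq_le ?_
  have hsa : IsSelfAdjoint (u : X) := congrArg Subtype.val husa
  calc ‖a - u * a‖ ^ 2 ≤ ‖s - u * s - (s - u * s) * u‖ := norm_sub_mul_sq_le hsa ha
    _ ≤ ‖s - u * s‖ + ‖s - u * s‖ * ‖(u : X)‖ :=
      (norm_sub_le _ _).trans (by gcongr; exact norm_mul_le _ _)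
    _ ≤ ‖s - u * s‖ + ‖s - u * s‖ * 1 := by gcongr; exact hu
    _ = ‖s - u * s‖ * 2 := by ring

end ApproximateUnits

/-! ### Weak integrals -/

section Barycenter

variable {S : Type*} [TopologicalSpace S] [CompactSpace S]

lemma isCompact_closure_range_induced {V ι : Type*} (f : ι → V → ℂ) (c : S → V)
    (hc : ∀ i, Continuous fun s => f i (c s)) :
    @IsCompact V (.induced (fun v i => f i v) inferInstance)
      (closure[.induced (fun v i => f i v) inferInstance] (Set.range c)) := by
  let _ : TopologicalSpace V := .induced (fun v i => f i v) inferInstance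
  have hind : IsInducing (fun (v : V) i => f i v) := ⟨rfl⟩
  have : R1Space V := hind.r1Space
  exact (isCompact_range (hind.continuous_iff.2 (continuous_pi hc))).closure

variable [MeasurableSpace S] [BorelSpace S] (μ : Measure S) [IsProbabilityMeasure μ]
  {V : Type*} [AddCommMonoid V] [Module ℂ V] [Module ℝ V] [IsScalarTower ℝ ℂ V]

lemma integral_mem_image_closure_convexHull [TopologicalSpace V] {E : Type*}
    [NormedAddCommGroup E] [NormedSpace ℂ E] [CompleteSpace E] {Φ : V →ₗ[ℂ] E}
    (hΦ : Continuous Φ) {c : S → V} (hc : Continuous c)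
    (hK : IsCompact (closure (convexHull ℝ (Set.range c)))) :
    ∫ s, Φ (c s) ∂μ ∈ Φ '' closure (convexHull ℝ (Set.range c)) := by
  have hint : Integrable (fun s => Φ (c s)) μ :=
    (hΦ.comp hc).integrable_of_hasCompactSupport (.of_compactSpace _)
  have hmem : ∫ s, Φ (c s) ∂μ ∈ closure (convexHull ℝ (Φ '' Set.range c)) :=
    (convex_convexHull ℝ _).closure.integral_mem isClosed_closure
      (.of_forall fun s => subset_closure (subset_convexHull ℝ _ ⟨c s, ⟨s, rfl⟩, rfl⟩)) hint
  refine closure_minimal ?_ (hK.image hΦ).isClosed hmem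
  have himage : Φ '' convexHull ℝ (Set.range c) = convexHull ℝ (Φ '' Set.range c) :=
    (Φ.restrictScalars ℝ).image_convexHull _
  exact himage ▸ Set.image_mono subset_closure

/-- By compactness, it suffices to treat finitely many functionals at a time, and there the
integral is a limit of convex combinations. -/
lemma exists_forall_eq_integral {ι : Type*} (f : ι → V →ₗ[ℂ] ℂ) (c : S → V)
    (hc : ∀ i, Continuous fun s => f i (c s))
    (hK : @IsCompact V (.induced (fun v i => f i v) inferInstance)
      (closure[.induced (fun v i => f i v) inferInstance] (convexHull ℝ (Set.range c)))) :
    ∃ v, ∀ i, f i v = ∫ s, f i (c s) ∂μ := by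
  let _ : TopologicalSpace V := .induced (fun v i => f i v) inferInstance
  have hind : IsInducing (fun (v : V) i => f i v) := ⟨rfl⟩
  have hcc : Continuous c := hind.continuous_iff.2 (continuous_pi hc)
  have hfc (i : ι) : Continuous (f i) := (continuous_apply i).comp hind.continuous
  obtain ⟨v, -, hv⟩ := hK.inter_iInter_nonempty (fun i => {v | f i v = ∫ s, f i (c s) ∂μ})
    (fun i => isClosed_eq (hfc i) continuous_const) fun t => by
      let Φ : V →ₗ[ℂ] (t → ℂ) := LinearMap.pi fun i => f i
      have hΦ : Continuous Φ := continuous_pi fun i => hfc i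
      obtain ⟨v, hv, hvΦ⟩ := integral_mem_image_closure_convexHull μ hΦ hcc hK
      refine ⟨v, hv, Set.mem_iInter₂.2 fun i hi => (congrFun hvΦ ⟨i, hi⟩).trans ?_⟩
      exact eval_integral (f := fun s => Φ (c s)) (fun j =>
        ((hfc j).comp hcc).integrable_of_hasCompactSupport (.of_compactSpace _)) _
  exact ⟨v, fun i => Set.mem_iInter.1 hv i⟩

end Barycenter

section DualPairs

variable {X : Type*} [NonUnitalCStarAlgebra X] {F : Submodule ℂ (StrongDual ℂ X)}

namespace IsCStarDualPair

lemma eq_zero (hF : IsCStarDualPair F) {x : X} (h : ∀ φ ∈ F, φ x = 0) : x = 0 := by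
  rw [← norm_le_zero_iff]
  refine (hF.norm_eq x).2 ?_
  rintro _ ⟨φ, hφ, -, rfl⟩
  simp [h φ hφ]

lemma ext (hF : IsCStarDualPair F) {x y : X} (h : ∀ φ ∈ F, φ x = φ y) : x = y :=
  sub_eq_zero.1 (hF.eq_zero fun φ hφ => by rw [map_sub, h φ hφ, sub_self])

lemma weakClosure_bot (hF : IsCStarDualPair F) : weakClosure (xDual F) (⊥ : Submodule ℂ X) = ⊥ :=
  eq_bot_iff.2 fun _ hx => (Submodule.mem_bot ℂ).2
    (hF.eq_zero fun φ hφ => mem_weakClosure_xDual.1 hx φ hφ (by simp))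

lemma weakClosure_matDual_bot (hF : IsCStarDualPair F) (n : ℕ) :
    weakClosure (matDual F n) (⊥ : Submodule ℂ (Matrix (Fin n) (Fin n) X)) = ⊥ := by
  refine eq_bot_iff.2 fun a ha => (Submodule.mem_bot ℂ).2 ?_
  ext i j
  have hentry := (weaklyContinuous_entry (F := F) i j).map_mem (R := ⊥) (fun s hs => by
    rw [(Submodule.mem_bot ℂ).1 hs]
    exact zero_mem _) ha
  rwa [hF.weakClosure_bot] at hentry

lemma weaklyContinuous_mul_left (hF : IsCStarDualPair F) (a : X) :
    WeaklyContinuous (xDual F) (xDual F) (fun x => a * x) :=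
  weaklyContinuous_of_continuous (LinearMap.mulLeft ℂ a) (hF.continuous_mul_left a)

lemma weaklyContinuous_mul_right (hF : IsCStarDualPair F) (a : X) :
    WeaklyContinuous (xDual F) (xDual F) (fun x => x * a) :=
  weaklyContinuous_of_continuous (LinearMap.mulRight ℂ a) (hF.continuous_mul_right a)

lemma exists_eq_star_apply_star (hF : IsCStarDualPair F) {φ : StrongDual ℂ X} (hφ : φ ∈ F) :
    ∃ ψ ∈ F, ∀ x, ψ x = star (φ (star x)) := by
  let ψ : X →ₗ[ℂ] ℂ :=
    { toFun := fun x => star (φ (star x))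
      map_add' := fun x y => by simp
      map_smul' := fun c x => by simp }
  have hψ : ψ ∈ xDual F := by
    let _ := fTopology F
    exact mem_xDual_iff_continuous.2
      ((mem_xDual_iff_continuous.1 (coe_mem_xDual hφ)).comp hF.continuous_star).star
  obtain ⟨ψ', hψ', h⟩ := mem_xDual.1 hψ
  exact ⟨ψ', hψ', fun x => LinearMap.congr_fun h x⟩

lemma eqOn_weakClosure (hF : IsCStarDualPair F) {V : Type*} [AddCommGroup V] [Module ℂ V]
    {D : Submodule ℂ (Module.Dual ℂ V)} {T₁ T₂ : V → X} (hT₁ : WeaklyContinuous D (xDual F) T₁)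
    (hT₂ : WeaklyContinuous D (xDual F) T₂) {S : Submodule ℂ V} (h : ∀ s ∈ S, T₁ s = T₂ s) {v : V}
    (hv : v ∈ weakClosure D S) : T₁ v = T₂ v := by
  refine hF.ext fun φ hφ => ?_
  obtain ⟨ψ₁, hψ₁, hψT₁⟩ := hT₁ φ (coe_mem_xDual hφ)
  obtain ⟨ψ₂, hψ₂, hψT₂⟩ := hT₂ φ (coe_mem_xDual hφ)
  have hsub := mem_weakClosure.1 hv (ψ₁ - ψ₂) (sub_mem hψ₁ hψ₂) fun s hs => by
    rw [LinearMap.sub_apply, hψT₁, hψT₂, h s hs, sub_self]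
  rwa [LinearMap.sub_apply, hψT₁, hψT₂, sub_eq_zero] at hsub

lemma mul_mem_weakClosure_span (hF : IsCStarDualPair F) {A B : Set X} {R : Submodule ℂ X}
    (h : ∀ a ∈ A, ∀ b ∈ B, a * b ∈ weakClosure (xDual F) R) {x y : X}
    (hx : x ∈ weakClosure (xDual F) (Submodule.span ℂ A))
    (hy : y ∈ weakClosure (xDual F) (Submodule.span ℂ B)) : x * y ∈ weakClosure (xDual F) R :=
  (hF.weaklyContinuous_mul_left x).map_mem_span
    (fun b hb => (hF.weaklyContinuous_mul_right b).map_mem_span (fun a ha => h a ha b hb) hx) hy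

lemma star_mem_weakClosure_span (hF : IsCStarDualPair F) {A : Set X} {R : Submodule ℂ X}
    (h : ∀ s ∈ A, star s ∈ weakClosure (xDual F) R) {x : X}
    (hx : x ∈ weakClosure (xDual F) (Submodule.span ℂ A)) : star x ∈ weakClosure (xDual F) R := by
  refine mem_weakClosure_xDual.2 fun φ hφ hR => ?_
  obtain ⟨ψ, hψ, hψφ⟩ := hF.exists_eq_star_apply_star hφ
  have hker : Submodule.span ℂ A ≤ LinearMap.ker (ψ : X →ₗ[ℂ] ℂ) :=
    Submodule.span_le.2 fun s hs => by simpa [hψφ] using mem_weakClosure_xDual.1 (h s hs) φ hφ hR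
  rw [← star_eq_zero, ← hψφ]
  exact mem_weakClosure_xDual.1 hx ψ hψ fun s hs => hker hs

end IsCStarDualPair

lemma IsFDynamicalSystem.weaklyContinuous {G : Type*} [Group G] [TopologicalSpace G]
    {α : G →* (X ≃⋆ₐ[ℂ] X)} (hα : IsFDynamicalSystem F α) (g : G) :
    WeaklyContinuous (xDual F) (xDual F) (α g) :=
  weaklyContinuous_of_continuous (α g : X →ₗ[ℂ] X) (hα.continuous_aut g)

end DualPairs

section Average

variable {X : Type*} [NonUnitalCStarAlgebra X]
  {G : Type*} [Group G] [TopologicalSpace G] [IsTopologicalGroup G] [CompactSpace G]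
  [MeasurableSpace G] [BorelSpace G]
  {F : Submodule ℂ (StrongDual ℂ X)} {α : G →* (X ≃⋆ₐ[ℂ] X)}

/-- The weak integral `∫ f(g) α_g(x) dg`, and `0` if there is none. -/
def avg (F : Submodule ℂ (StrongDual ℂ X)) (α : G →* (X ≃⋆ₐ[ℂ] X)) (f : G → ℂ) (x : X) : X :=
  open Classical in
  if h : ∃ y, IsWeakIntegral F (haar G) (fun g => f g • α g x) y then h.choose else 0

lemma exists_isWeakIntegral (hF : IsCStarDualPair F) (hα : IsFDynamicalSystem F α) {f : G → ℂ}
    (hf : Continuous f) (x : X) :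
    ∃ y, IsWeakIntegral F (haar G) (fun g => f g • α g x) y := by
  have hc (φ : F) : Continuous fun g => φ.1 (f g • α g x) := by
    simp only [map_smul, smul_eq_mul]
    exact hf.mul (hα.continuous_orbit x φ.1 φ.2)
  obtain ⟨y, hy⟩ := exists_forall_eq_integral (haar G) (fun φ : F => (φ.1 : X →ₗ[ℂ] ℂ)) _ hc
    (hF.convexHull_left _ (isCompact_closure_range_induced _ _ hc))
  exact ⟨y, fun φ hφ => hy ⟨φ, hφ⟩⟩

lemma apply_avg (hF : IsCStarDualPair F) (hα : IsFDynamicalSystem F α) {f : G → ℂ}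
    (hf : Continuous f) (x : X) {φ : StrongDual ℂ X} (hφ : φ ∈ F) :
    φ (avg F α f x) = ∫ g, f g * φ (α g x) ∂(haar G) := by
  have h := exists_isWeakIntegral hF hα hf x
  rw [avg, dif_pos h]
  simpa using h.choose_spec φ hφ

lemma avg_eq (hF : IsCStarDualPair F) (hα : IsFDynamicalSystem F α) {f : G → ℂ}
    (hf : Continuous f) {x y : X} (h : ∀ φ ∈ F, φ y = ∫ g, f g * φ (α g x) ∂(haar G)) :
    avg F α f x = y :=
  hF.ext fun φ hφ => by rw [apply_avg hF hα hf x hφ, h φ hφ]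

lemma IsCStarDualPair.exists_apply_eq_integral (hF : IsCStarDualPair F) (c : G → F)
    (hc : ∀ x, Continuous fun g => (c g).1 x) :
    ∃ ψ ∈ F, ∀ x, ψ x = ∫ g, (c g).1 x ∂(haar G) := by
  let eval (x : X) : F →ₗ[ℂ] ℂ :=
    { toFun := fun ψ => ψ.1 x, map_add' := fun _ _ => rfl, map_smul' := fun _ _ => rfl }
  obtain ⟨ψ, hψ⟩ := exists_forall_eq_integral (haar G) eval c hc
    (hF.convexHull_right _ (isCompact_closure_range_induced (fun x (ψ : F) => ψ.1 x) c hc))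
  exact ⟨ψ, ψ.2, hψ⟩

lemma weaklyContinuous_avg (hF : IsCStarDualPair F) (hα : IsFDynamicalSystem F α) {f : G → ℂ}
    (hf : Continuous f) : WeaklyContinuous (xDual F) (xDual F) (avg F α f) := by
  refine weaklyContinuous_xDual_iff.2 fun φ hφ => ?_
  choose c hcF hc using fun g =>
    weaklyContinuous_xDual_iff.1 ((hα.weaklyContinuous g).smul (f g)) φ hφ
  simp only [map_smul, smul_eq_mul] at hc
  obtain ⟨ψ, hψF, hψ⟩ := hF.exists_apply_eq_integral (fun g => ⟨c g, hcF g⟩) fun x => by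
    simp only [hc]
    exact hf.mul (hα.continuous_orbit x φ hφ)
  exact ⟨ψ, hψF, fun x => by simp only [hψ, hc, apply_avg hF hα hf x hφ]⟩

lemma avg_mem (hF : IsCStarDualPair F) (hα : IsFDynamicalSystem F α) {f : G → ℂ}
    (hf : Continuous f) {S : Submodule ℂ X} (hS : weakClosure (xDual F) S ≤ S) {x : X}
    (hx : ∀ g, α g x ∈ S) : avg F α f x ∈ S := by
  refine hS (mem_weakClosure_xDual.2 fun φ hφ h => ?_)
  rw [apply_avg hF hα hf x hφ]
  simp [h _ (hx _)]

lemma map_avg (hF : IsCStarDualPair F) (hα : IsFDynamicalSystem F α) {f : G → ℂ}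
    (hf : Continuous f) (h : G) (x : X) :
    α h (avg F α f x) = avg F α (fun g => f (h⁻¹ * g)) x := by
  refine (avg_eq hF hα (by fun_prop) fun φ hφ => ?_).symm
  obtain ⟨ψ, hψ, hψφ⟩ := weaklyContinuous_xDual_iff.1 (hα.weaklyContinuous h) φ hφ
  rw [← hψφ, apply_avg hF hα hf x hψ,
    ← integral_mul_left_eq_self (fun g => f (h⁻¹ * g) * φ (α g x)) h]
  simp only [inv_mul_cancel_left, map_mul, hψφ]
  rfl

lemma avg_sum_mul (hF : IsCStarDualPair F) (hα : IsFDynamicalSystem F α) {ι : Type*}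
    (s : Finset ι) (c : ι → ℂ) (f : ι → G → ℂ) (hf : ∀ i, Continuous (f i)) (x : X) :
    avg F α (fun g => ∑ i ∈ s, c i * f i g) x = ∑ i ∈ s, c i • avg F α (f i) x := by
  refine avg_eq hF hα (by fun_prop) fun φ hφ => ?_
  have ho := hα.continuous_orbit x φ hφ
  simp only [map_sum, map_smul, smul_eq_mul, apply_avg hF hα (hf _) x hφ, Finset.sum_mul]
  rw [integral_finsetSum _ fun i _ =>
    integrable_of_continuous (f := fun g => c i * f i g * φ (α g x))
      ((continuous_const.mul (hf i)).mul ho)]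
  simp only [← integral_const_mul, mul_assoc]

lemma avg_eq_sum (hF : IsCStarDualPair F) (hα : IsFDynamicalSystem F α) {f : G → ℂ}
    (hf : Continuous f) {ι : Type*} [Fintype ι] {x : X} {m : ι → G → ℂ} (hm : ∀ i, Continuous (m i))
    {a : ι → X} (hx : ∀ g, α g x = ∑ i, m i g • a i) :
    avg F α f x = ∑ i, (∫ g, f g * m i g ∂(haar G)) • a i := by
  refine avg_eq hF hα hf fun φ _ => ?_
  simp only [hx, map_sum, map_smul, smul_eq_mul, Finset.mul_sum]
  rw [integral_finsetSum _ fun i _ => integrable_of_continuous (by fun_prop)]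
  simp only [← integral_mul_const, mul_assoc]

lemma sum_avg_eq (hF : IsCStarDualPair F) (hα : IsFDynamicalSystem F α) {ι : Type*} [Fintype ι]
    {f : ι → G → ℂ} (hf : ∀ i, Continuous (f i)) {x : ι → X} {y : X}
    (h : ∀ g, ∑ i, f i g • α g (x i) = y) : ∑ i, avg F α (f i) (x i) = y := by
  refine hF.ext fun φ hφ => ?_
  have hφy (g : G) : ∑ i, f i g * φ (α g (x i)) = φ y := by
    simp only [← h g, map_sum, map_smul, smul_eq_mul]
  simp only [map_sum, apply_avg hF hα (hf _) _ hφ]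
  rw [← integral_finsetSum _ fun i _ =>
    integrable_of_continuous (f := fun g => f i g * φ (α g (x i)))
      ((hf i).mul (hα.continuous_orbit (x i) φ hφ))]
  simp only [hφy, integral_const, probReal_univ, one_smul]

lemma mul_avg (hF : IsCStarDualPair F) (hα : IsFDynamicalSystem F α) {f : G → ℂ}
    (hf : Continuous f) {y : X} (hy : ∀ g, α g y = y) (x : X) :
    avg F α f (y * x) = y * avg F α f x := by
  refine avg_eq hF hα hf fun φ hφ => ?_
  obtain ⟨ψ, hψ, hψφ⟩ := weaklyContinuous_xDual_iff.1 (hF.weaklyContinuous_mul_left y) φ hφ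
  simp only [map_mul, hy, ← hψφ, apply_avg hF hα hf x hψ]

lemma avg_mul (hF : IsCStarDualPair F) (hα : IsFDynamicalSystem F α) {f : G → ℂ}
    (hf : Continuous f) {y : X} (hy : ∀ g, α g y = y) (x : X) :
    avg F α f (x * y) = avg F α f x * y := by
  refine avg_eq hF hα hf fun φ hφ => ?_
  obtain ⟨ψ, hψ, hψφ⟩ := weaklyContinuous_xDual_iff.1 (hF.weaklyContinuous_mul_right y) φ hφ
  simp only [map_mul, hy, ← hψφ, apply_avg hF hα hf x hψ]

lemma star_avg (hF : IsCStarDualPair F) (hα : IsFDynamicalSystem F α) {f : G → ℂ}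
    (hf : Continuous f) (x : X) :
    star (avg F α f x) = avg F α (fun g => star (f g)) (star x) := by
  refine (avg_eq hF hα hf.star fun φ hφ => ?_).symm
  obtain ⟨ψ, hψ, hψφ⟩ := hF.exists_eq_star_apply_star hφ
  have hφψ (x : X) : φ (star x) = star (ψ x) := by rw [hψφ, star_star]
  rw [hφψ, apply_avg hF hα hf x hψ, RCLike.star_def, ← integral_conj]
  simp only [map_mul, map_star, hφψ, RCLike.star_def]

end Average

/-! ### Rows of spectral subspaces -/

section Matrices

variable {X : Type*} [NonUnitalCStarAlgebra X] {n : ℕ}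

lemma mulScalar_mulScalar (a : Matrix (Fin n) (Fin n) X) (u v : Matrix (Fin n) (Fin n) ℂ) :
    mulScalar (mulScalar a u) v = mulScalar a (u * v) := by
  ext i j
  simp only [mulScalar, Matrix.mul_apply, of_apply, Finset.smul_sum, Finset.sum_smul, smul_smul]
  rw [Finset.sum_comm]
  simp only [mul_comm]

lemma mulScalar_one (a : Matrix (Fin n) (Fin n) X) :
    mulScalar a (1 : Matrix (Fin n) (Fin n) ℂ) = a := by
  ext i j
  simp [mulScalar, Matrix.one_apply, ite_smul]

/-- The matrix `a* b` for rows `a` and `b`. -/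
def outer (a b : Fin n → X) : Matrix (Fin n) (Fin n) X := vecMulVec (star a) b

lemma outer_mul (a b : Fin n → X) (c : Matrix (Fin n) (Fin n) X) :
    outer a b * c = outer a (b ᵥ* c) :=
  vecMulVec_mul _ _ _

lemma mul_outer (a b : Fin n → X) (c : Matrix (Fin n) (Fin n) X) :
    c * outer a b = outer (a ᵥ* cᴴ) b := by
  rw [outer, mul_vecMulVec, outer, star_vecMul, conjTranspose_conjTranspose]

lemma sum_mul_star_ne_zero [PartialOrder X] [StarOrderedRing X] {ι : Type*} [Fintype ι] {a : ι → X}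
    {k : ι} (hk : a k ≠ 0) : ∑ i, a i * star (a i) ≠ 0 := fun h =>
  hk <| (CStarRing.mul_star_self_eq_zero_iff _).1 <|
    (Finset.sum_eq_zero_iff_of_nonneg fun i _ => mul_star_self_nonneg (a i)).1 h k
      (Finset.mem_univ k)

end Matrices

section Rows

variable {X : Type*} [NonUnitalCStarAlgebra X]
  {G : Type*} [Group G] [TopologicalSpace G]
  {α : G →* (X ≃⋆ₐ[ℂ] X)} {π : IrrRep G}

/-- The rows of the elements of `X₂(π)`. -/
def IsRow (α : G →* (X ≃⋆ₐ[ℂ] X)) (π : IrrRep G) (a : Fin π.dim → X) : Prop :=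
  ∀ g k, α g (a k) = ∑ m, π.mat g m k • a m

/-- The fixed point algebra of `α`. -/
def fixedPts (α : G →* (X ≃⋆ₐ[ℂ] X)) : NonUnitalStarSubalgebra ℂ X where
  carrier := {x | ∀ g, α g x = x}
  add_mem' ha hb g := by rw [map_add, ha g, hb g]
  zero_mem' g := map_zero _
  smul_mem' c x hx g := by rw [map_smul, hx g]
  mul_mem' ha hb g := by rw [map_mul, ha g, hb g]
  star_mem' ha g := by rw [map_star, ha g]

lemma mem_spectralSubspaceTwo {Y : NonUnitalStarSubalgebra ℂ X}
    {a : Matrix (Fin π.dim) (Fin π.dim) X} :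
    a ∈ spectralSubspaceTwo α Y π ↔ ∀ i, IsRow α π (a i) ∧ ∀ j, a i j ∈ Y := by
  have hmap (g : G) : a.map (α g) = mulScalar a (π.mat g) ↔
      ∀ i k, α g (a i k) = ∑ m, π.mat g m k • a i m :=
    ⟨fun h i k => congrFun (congrFun h i) k, fun h => by ext i k; exact h i k⟩
  simp only [spectralSubspaceTwo, Set.mem_ofPred_eq, hmap, IsRow]
  exact ⟨fun h i => ⟨fun g k => h.2 g i k, h.1 i⟩,
    fun h => ⟨fun i => (h i).2, fun g i => (h i).1 g⟩⟩

lemma tensorAd_eq_iff_map {g : G} {c : Matrix (Fin π.dim) (Fin π.dim) X} :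
    tensorAd α π g c = c ↔
      c.map (α g) = mulScalar (scalarMul (π.mat g)ᴴ c) (π.mat g) := by
  constructor
  · intro h
    conv_rhs => rw [← h]
    rw [tensorAd, scalarMul_mulScalar, scalarMul_scalarMul, mulScalar_mulScalar, mat_inv_mul,
      ← mat_inv, mat_inv_mul, mulScalar_one, one_scalarMul]
  · intro h
    rw [tensorAd, h, scalarMul_mulScalar, scalarMul_scalarMul, mulScalar_mulScalar, mat_inv,
      mat_mul_conjTranspose, mulScalar_one, one_scalarMul]

lemma mem_fixedAlgebra {Y : NonUnitalStarSubalgebra ℂ X} {c : Matrix (Fin π.dim) (Fin π.dim) X} :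
    c ∈ fixedAlgebra α Y π ↔ (∀ i j, c i j ∈ Y) ∧ ∀ g i j,
      α g (c i j) = ∑ p, ∑ q, (star (π.mat g p i) * π.mat g q j) • c p q := by
  have hentry (g : G) (i j : Fin π.dim) : mulScalar (scalarMul (π.mat g)ᴴ c) (π.mat g) i j =
      ∑ p, ∑ q, (star (π.mat g p i) * π.mat g q j) • c p q := by
    simp only [mulScalar, scalarMul, of_apply, conjTranspose_apply, Finset.smul_sum, smul_smul]
    rw [Finset.sum_comm]
    simp only [mul_comm]
  simp only [← hentry]
  exact and_congr_right fun _ => forall_congr' fun g => tensorAd_eq_iff_map.trans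
    ⟨fun h i j => congrFun (congrFun h i) j, fun h => by ext i j; exact h i j⟩

lemma isRow_iff_map {a : Fin π.dim → X} :
    IsRow α π a ↔ ∀ g, (replicateRow (Fin π.dim) a).map (α g) =
      mulScalar (replicateRow (Fin π.dim) a) (π.mat g) :=
  ⟨fun h g => by ext _ k; exact h g k, fun h g k => congrFun (congrFun (h g) k) k⟩

namespace IsRow

variable {a b : Fin π.dim → X}

lemma outer_mem (ha : IsRow α π a) (hb : IsRow α π b) {Y : NonUnitalStarSubalgebra ℂ X}
    (haY : ∀ k, a k ∈ Y) (hbY : ∀ k, b k ∈ Y) : outer a b ∈ fixedAlgebra α Y π := by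
  refine mem_fixedAlgebra.2 ⟨fun i j => mul_mem (star_mem (haY i)) (hbY j), fun g i j => ?_⟩
  simp only [outer, vecMulVec_apply, Pi.star_apply, map_mul, map_star, ha g i, hb g j, star_sum,
    star_smul, Finset.sum_mul, Finset.mul_sum, smul_mul_assoc, mul_smul_comm, Finset.smul_sum,
    smul_smul]
  rw [Finset.sum_comm]
  exact Finset.sum_congr rfl fun p _ => Finset.sum_congr rfl fun q _ => by rw [mul_comm]

lemma sum_mul_star_mem (ha : IsRow α π a) (hb : IsRow α π b) :
    ∑ k, a k * star (b k) ∈ fixedPts α := by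
  intro g
  let i₀ : Fin π.dim := ⟨0, π.dim_pos⟩
  have hfixed : (replicateRow (Fin π.dim) a * (replicateRow (Fin π.dim) b)ᴴ).map (α g) =
      replicateRow (Fin π.dim) a * (replicateRow (Fin π.dim) b)ᴴ := by
    rw [Matrix.map_mul, conjTranspose_map _ (map_star (α g)), isRow_iff_map.1 ha,
      isRow_iff_map.1 hb, conjTranspose_mulScalar, mulScalar_mul, scalarMul_scalarMul,
      mat_mul_conjTranspose, one_scalarMul]
  simpa [Matrix.mul_apply] using congrFun (congrFun hfixed i₀) i₀

lemma vecMul (ha : IsRow α π a) {Y : NonUnitalStarSubalgebra ℂ X}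
    {c : Matrix (Fin π.dim) (Fin π.dim) X} (hc : c ∈ fixedAlgebra α Y π) :
    IsRow α π (a ᵥ* c) := by
  refine isRow_iff_map.2 fun g => ?_
  rw [replicateRow_vecMul, Matrix.map_mul, isRow_iff_map.1 ha,
    tensorAd_eq_iff_map.1 (hc.2 g), mulScalar_mul, scalarMul_mulScalar, scalarMul_scalarMul,
    mat_mul_conjTranspose, one_scalarMul, mul_mulScalar]

lemma mul_left (ha : IsRow α π a) {y : X} (hy : y ∈ fixedPts α) :
    IsRow α π (fun k => y * a k) := by
  intro g k
  simp only [map_mul, hy g, ha g k, Finset.mul_sum, mul_smul_comm]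

lemma mul_right (ha : IsRow α π a) {y : X} (hy : y ∈ fixedPts α) :
    IsRow α π (fun k => a k * y) := by
  intro g k
  simp only [map_mul, hy g, ha g k, Finset.sum_mul, smul_mul_assoc]

end IsRow

lemma spectralIdeal_eq_span (Y : NonUnitalStarSubalgebra ℂ X) :
    spectralIdeal α Y π = Submodule.span ℂ {c | ∃ a b : Fin π.dim → X, IsRow α π a ∧
      IsRow α π b ∧ (∀ k, a k ∈ Y) ∧ (∀ k, b k ∈ Y) ∧ c = outer a b} := by
  refine le_antisymm (Submodule.span_le.2 ?_) (Submodule.span_le.2 ?_)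
  · rintro _ ⟨a, ha, b, hb, rfl⟩
    rw [mem_spectralSubspaceTwo] at ha hb
    have hsum : aᴴ * b = ∑ i, outer (a i) (b i) := by
      ext k l
      simp [Matrix.mul_apply, outer, vecMulVec_apply, Matrix.sum_apply]
    rw [hsum]
    exact sum_mem fun i _ => Submodule.subset_span
      ⟨a i, b i, (ha i).1, (hb i).1, (ha i).2, (hb i).2, rfl⟩
  · rintro _ ⟨a, b, ha, hb, haY, hbY, rfl⟩
    let i₀ : Fin π.dim := ⟨0, π.dim_pos⟩
    have hmem (a : Fin π.dim → X) (ha : IsRow α π a) (haY : ∀ k, a k ∈ Y) :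
        of (fun i k => if i = i₀ then a k else 0) ∈ spectralSubspaceTwo α Y π := by
      refine mem_spectralSubspaceTwo.2 fun i => ?_
      by_cases hi : i = i₀
      · exact ⟨fun g k => by simpa [hi] using ha g k, fun k => by simpa [hi] using haY k⟩
      · exact ⟨fun g k => by simp [hi], fun k => by simp [hi]⟩
    refine Submodule.subset_span ⟨_, hmem a ha haY, _, hmem b hb hbY, ?_⟩
    ext k l
    simp [Matrix.mul_apply, outer, vecMulVec_apply]

lemma spectralIdeal_le (Y : NonUnitalStarSubalgebra ℂ X) (π : IrrRep G) :
    spectralIdeal α Y π ≤ (fixedAlgebra α Y π).toSubmodule := by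
  rw [spectralIdeal_eq_span, Submodule.span_le]
  rintro _ ⟨a, b, ha, hb, haY, hbY, rfl⟩
  exact ha.outer_mem hb haY hbY

variable {F : Submodule ℂ (StrongDual ℂ X)}

lemma IrrRep.continuous_chi (π : IrrRep G) : Continuous π.chi :=
  continuous_const.mul (continuous_finsetSum _ fun i _ => (continuous_mat π i i).star)

lemma continuous_mat_mul_star_mat (π : IrrRep G) (i k j l : Fin π.dim) :
    Continuous fun g => π.mat g i k * star (π.mat g j l) :=
  (continuous_mat π i k).mul (continuous_mat π j l).star

lemma weakClosure_fixedPts_le (hF : IsCStarDualPair F) (hα : IsFDynamicalSystem F α) :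
    weakClosure (xDual F) (fixedPts α).toSubmodule ≤ (fixedPts α).toSubmodule :=
  fun _ hx g => hF.eqOn_weakClosure (T₁ := α g) (T₂ := id) (hα.weaklyContinuous g)
    (fun φ hφ => ⟨φ, hφ, fun _ => rfl⟩) (fun s (hs : s ∈ fixedPts α) => hs g) hx

lemma weakClosure_fixedAlgebra_le (hF : IsCStarDualPair F) (hα : IsFDynamicalSystem F α)
    {Y : NonUnitalStarSubalgebra ℂ X} (hY : weakClosure (xDual F) Y.toSubmodule ≤ Y.toSubmodule)
    (π : IrrRep G) : weakClosure (matDual F π.dim) (fixedAlgebra α Y π).toSubmodule ≤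
      (fixedAlgebra α Y π).toSubmodule := by
  intro c hc
  refine mem_fixedAlgebra.2 ⟨fun i j => hY ?_, fun g i j => ?_⟩
  · exact (weaklyContinuous_entry i j).map_mem
      (fun s hs => le_weakClosure _ _ ((mem_fixedAlgebra.1 hs).1 i j)) hc
  · exact hF.eqOn_weakClosure ((hα.weaklyContinuous g).comp (weaklyContinuous_entry i j))
      (.sum fun p _ => .sum fun q _ => (weaklyContinuous_entry p q).smul _)
      (fun s hs => (mem_fixedAlgebra.1 hs).2 g i j) hc

end Rows

section RowAverages

variable {X : Type*} [NonUnitalCStarAlgebra X]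
  {G : Type*} [Group G] [TopologicalSpace G] [IsTopologicalGroup G] [CompactSpace G]
  [MeasurableSpace G] [BorelSpace G]
  {F : Submodule ℂ (StrongDual ℂ X)} {α : G →* (X ≃⋆ₐ[ℂ] X)}

lemma isRow_avg (hF : IsCStarDualPair F) (hα : IsFDynamicalSystem F α) (π : IrrRep G)
    (j : Fin π.dim) (x : X) : IsRow α π (fun k => avg F α (fun g => star (π.mat g k j)) x) := by
  intro h k
  have hc (m : Fin π.dim) : Continuous fun g => star (π.mat g m j) := (continuous_mat π m j).star
  rw [map_avg hF hα (hc k), ← avg_sum_mul hF hα _ _ _ hc]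
  congr 1
  ext g
  simp only [mat_mul, Matrix.mul_apply, star_sum, star_mul', mat_inv, conjTranspose_apply,
    star_star]

lemma IsRow.sum_avg (hF : IsCStarDualPair F) (hα : IsFDynamicalSystem F α) {π : IrrRep G}
    {a : Fin π.dim → X} (ha : IsRow α π a) (j : Fin π.dim) :
    ∑ k, avg F α (fun g => star (π.mat g j k)) (a k) = a j := by
  refine sum_avg_eq hF hα (fun k => (continuous_mat π j k).star) fun g => ?_
  simp only [ha g, Finset.smul_sum, smul_smul]
  rw [Finset.sum_comm]
  simp only [← Finset.sum_smul, mul_comm (star _), sum_mat_mul_star_mat, ite_smul, one_smul,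
    zero_smul, Finset.sum_ite_eq', Finset.mem_univ, if_true]

/-- By the Peter–Weyl theorem, a function of the form `g ↦ φ(α_g(x))` vanishes if its Fourier
coefficients do, and these are the values of `φ` at entries of rows. -/
lemma mem_weakClosure_of_rows (hF : IsCStarDualPair F) (hα : IsFDynamicalSystem F α)
    {Y R : Submodule ℂ X} (hY : weakClosure (xDual F) Y ≤ Y) (hinv : ∀ g, ∀ y ∈ Y, α g y ∈ Y)
    (hR : ∀ (c : DualSet G) (a : Fin c.rep.dim → X), IsRow α c.rep a → (∀ k, a k ∈ Y) →
      ∀ k, a k ∈ weakClosure (xDual F) R) {x : X} (hx : x ∈ Y) : x ∈ weakClosure (xDual F) R := by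
  refine mem_weakClosure_xDual.2 fun φ hφ hφR => ?_
  have hzero : (fun g => φ (α g x)) = 0 :=
    eq_zero_of_integral_star_mat_mul (hα.continuous_orbit x φ hφ) fun c i j => by
      have hc (k : Fin c.rep.dim) : Continuous fun g => star (c.rep.mat g k j) :=
        (continuous_mat c.rep k j).star
      rw [← apply_avg hF hα (hc i) x hφ]
      exact mem_weakClosure_xDual.1 (hR c _ (isRow_avg hF hα c.rep j x)
        (fun k => avg_mem hF hα (hc k) hY fun g => hinv g x hx) i) φ hφ hφR
  simpa using congrFun hzero 1

lemma exists_row_ne_zero (hF : IsCStarDualPair F) (hα : IsFDynamicalSystem F α)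
    {Y : Submodule ℂ X} (hY : weakClosure (xDual F) Y ≤ Y) (hinv : ∀ g, ∀ y ∈ Y, α g y ∈ Y)
    (hne : ∃ y ∈ Y, y ≠ 0) : ∃ (c : DualSet G) (a : Fin c.rep.dim → X), IsRow α c.rep a ∧
      (∀ k, a k ∈ Y) ∧ ∃ k, a k ≠ 0 := by
  by_contra! hcon
  obtain ⟨y, hy, hy0⟩ := hne
  have hbot := mem_weakClosure_of_rows hF hα (R := ⊥) hY hinv
    (fun c a ha haY k => by rw [hcon c a ha haY k]; exact zero_mem _) hy
  rw [hF.weakClosure_bot] at hbot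
  exact hy0 hbot

lemma mem_spectralSubspaceOne_iff (hF : IsCStarDualPair F) (hα : IsFDynamicalSystem F α)
    {π : IrrRep G} {x : X} : x ∈ spectralSubspaceOne F α π ↔ avg F α π.chi x = x := by
  have hspec (φ : StrongDual ℂ X) (hφ : φ ∈ F) :
      φ (avg F α π.chi x) = ∫ g, φ (π.chi g • α g x) ∂(haar G) := by
    simpa using apply_avg hF hα π.continuous_chi x hφ
  exact ⟨fun h => hF.ext fun φ hφ => (hspec φ hφ).trans (h φ hφ).symm,
    fun h φ hφ => by rw [← hspec φ hφ, h]⟩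

lemma avg_chi (hF : IsCStarDualPair F) (hα : IsFDynamicalSystem F α) (π : IrrRep G) (x : X) :
    avg F α π.chi x = ∑ i, (π.dim : ℂ) • avg F α (fun g => star (π.mat g i i)) x := by
  rw [← avg_sum_mul hF hα _ _ _ fun i => (continuous_mat π i i).star]
  simp only [← Finset.mul_sum]
  rfl

lemma IsRow.smul_avg (hF : IsCStarDualPair F) (hα : IsFDynamicalSystem F α) {π : IrrRep G}
    {a : Fin π.dim → X} (ha : IsRow α π a) (i j k : Fin π.dim) :
    (π.dim : ℂ) • avg F α (fun g => star (π.mat g i j)) (a k) = if j = k then a i else 0 := by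
  rw [avg_eq_sum hF hα (continuous_mat π i j).star (fun m => continuous_mat π m k) (ha · k)]
  simp only [Finset.smul_sum, smul_smul, integral_star_mat_mul_mat]
  by_cases hjk : j = k <;> simp [hjk]

lemma IsRow.mem_spectralSubspaceOne (hF : IsCStarDualPair F) (hα : IsFDynamicalSystem F α)
    {π : IrrRep G} {a : Fin π.dim → X} (ha : IsRow α π a) (k : Fin π.dim) :
    a k ∈ spectralSubspaceOne F α π := by
  rw [mem_spectralSubspaceOne_iff hF hα, avg_chi hF hα]
  simp only [ha.smul_avg hF hα, Finset.sum_ite_eq', Finset.mem_univ, if_true]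

lemma mem_spectrumOf_iff (hF : IsCStarDualPair F) (hα : IsFDynamicalSystem F α) {c : DualSet G} :
    c ∈ spectrumOf F α ↔ ∃ a : Fin c.rep.dim → X, IsRow α c.rep a ∧ ∃ k, a k ≠ 0 := by
  constructor
  · contrapose!
    intro hrows
    refine not_not.2 (Set.eq_singleton_iff_unique_mem.2 ⟨fun φ _ => by simp, fun x hx => ?_⟩)
    rw [mem_spectralSubspaceOne_iff hF hα, avg_chi hF hα] at hx
    rw [← hx]
    exact Finset.sum_eq_zero fun i _ => by rw [hrows _ (isRow_avg hF hα c.rep i x) i, smul_zero]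
  · rintro ⟨a, ha, k, hk⟩ h
    have hmem := ha.mem_spectralSubspaceOne hF hα k
    rw [h] at hmem
    exact hk hmem

/-- The average of `(α ⊗ ad π)_g (x ⊗ e_kl)` over `g`, that is, the projection of `x ⊗ e_kl` onto
the fixed point algebra of `α ⊗ ad π`. -/
def tensorAvg (F : Submodule ℂ (StrongDual ℂ X)) (α : G →* (X ≃⋆ₐ[ℂ] X)) (π : IrrRep G)
    (k l : Fin π.dim) (x : X) : Matrix (Fin π.dim) (Fin π.dim) X :=
  of fun i j => avg F α (fun g => π.mat g i k * star (π.mat g j l)) x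

lemma tensorAvg_mem (hF : IsCStarDualPair F) (hα : IsFDynamicalSystem F α) (π : IrrRep G)
    (k l : Fin π.dim) (x : X) : tensorAvg F α π k l x ∈ fixedAlgebra α ⊤ π := by
  refine mem_fixedAlgebra.2 ⟨fun _ _ => trivial, fun h i j => ?_⟩
  have hc := continuous_mat_mul_star_mat π
  simp only [tensorAvg, of_apply]
  rw [map_avg hF hα (hc _ _ _ _), ← Fintype.sum_prod_type',
    ← avg_sum_mul hF hα _ (fun p : Fin π.dim × Fin π.dim => star (π.mat h p.1 i) * π.mat h p.2 j)
      _ (fun p => hc _ _ _ _)]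
  congr 1
  ext g
  simp only [mat_mul, Matrix.mul_apply, star_sum, star_mul', mat_inv, conjTranspose_apply,
    star_star, Finset.sum_mul, Finset.mul_sum, Fintype.sum_prod_type]
  rw [Finset.sum_comm]
  exact Finset.sum_congr rfl fun p _ => Finset.sum_congr rfl fun q _ => by ring

lemma sum_tensorAvg (hF : IsCStarDualPair F) (hα : IsFDynamicalSystem F α) {π : IrrRep G}
    {Y : NonUnitalStarSubalgebra ℂ X} {c : Matrix (Fin π.dim) (Fin π.dim) X}
    (hc : c ∈ fixedAlgebra α Y π) : ∑ k, ∑ l, tensorAvg F α π k l (c k l) = c := by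
  ext i j
  simp only [Matrix.sum_apply, tensorAvg, of_apply]
  rw [← Fintype.sum_prod_type']
  refine sum_avg_eq hF hα (fun p => continuous_mat_mul_star_mat π _ _ _ _) fun g => ?_
  conv_rhs => rw [← hc.2 g]
  simp only [tensorAd, mulScalar, scalarMul, of_apply, mat_inv, conjTranspose_apply,
    Finset.smul_sum, smul_smul, Matrix.map_apply, Fintype.sum_prod_type]
  rw [Finset.sum_comm]
  exact Finset.sum_congr rfl fun p _ => Finset.sum_congr rfl fun q _ => by rw [mul_comm]

lemma weaklyContinuous_tensorAvg (hF : IsCStarDualPair F) (hα : IsFDynamicalSystem F α)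
    (π : IrrRep G) (k l : Fin π.dim) :
    WeaklyContinuous (xDual F) (matDual F π.dim) (tensorAvg F α π k l) :=
  .of_entries fun _ _ => weaklyContinuous_avg hF hα (continuous_mat_mul_star_mat π _ _ _ _)

end RowAverages

/-! ### Fixed points -/

section Hereditary

lemma mul_mul_star_polarization {A : Type*} [NonUnitalRing A] [StarRing A] [Module ℂ A]
    [StarModule ℂ A] [IsScalarTower ℂ A A] [SMulCommClass ℂ A A] (x y w : A) :
    y * x * star w = (4⁻¹ : ℂ) •
      ((y + w) * x * star (y + w) - (y - w) * x * star (y - w) +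
        Complex.I • ((y + Complex.I • w) * x * star (y + Complex.I • w) -
          (y - Complex.I • w) * x * star (y - Complex.I • w))) := by
  simp only [star_add, star_sub, star_smul, mul_add, add_mul, mul_sub, sub_mul, smul_mul_assoc,
    mul_smul_comm, smul_add, smul_sub, smul_smul, RCLike.star_def, Complex.conj_I]
  match_scalars <;> ring_nf <;> simp; norm_num

variable {X : Type*} [NonUnitalCStarAlgebra X] [PartialOrder X] [StarOrderedRing X]

lemma mul_mul_mem_of_hereditary {Y : NonUnitalStarSubalgebra ℂ X}
    (hY : ∀ x y : X, 0 ≤ x → x ≤ y → y ∈ Y → x ∈ Y) {y z : X} (hy : y ∈ Y) (x : X) (hz : z ∈ Y) :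
    y * x * z ∈ Y := by
  have hconj {x : X} (hx : 0 ≤ x) {y : X} (hy : y ∈ Y) : y * x * star y ∈ Y := by
    refine hY _ (‖x‖ • (y * star y)) (star_right_conjugate_nonneg hx y)
      (CStarAlgebra.star_right_conjugate_le_norm_smul (.of_nonneg hx)) ?_
    rw [← Complex.coe_smul]
    exact SMulMemClass.smul_mem _ (mul_mem hy (star_mem hy))
  have hnonneg {x : X} (hx : 0 ≤ x) : y * x * z ∈ Y := by
    have hw : star z ∈ Y := star_mem hz
    have hIw : Complex.I • star z ∈ Y := SMulMemClass.smul_mem _ hw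
    rw [← star_star z, mul_mul_star_polarization]
    exact SMulMemClass.smul_mem _ <| add_mem
      (sub_mem (hconj hx (add_mem hy hw)) (hconj hx (sub_mem hy hw)))
      (SMulMemClass.smul_mem _ <|
        sub_mem (hconj hx (add_mem hy hIw)) (hconj hx (sub_mem hy hIw)))
  have hspan : Submodule.span ℂ {a : X | 0 ≤ a} ≤
      Y.toSubmodule.comap ((LinearMap.mulRight ℂ z).comp (LinearMap.mulLeft ℂ y)) :=
    Submodule.span_le.2 fun _ hx => hnonneg hx
  rw [CStarAlgebra.span_nonneg] at hspan
  exact hspan (Submodule.mem_top (x := x))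

lemma mem_weakClosure_of_sum_mul_star_mem {F : Submodule ℂ (StrongDual ℂ X)}
    {S : NonUnitalStarSubalgebra ℂ X} (hS : weakClosure (xDual F) S.toSubmodule ≤ S.toSubmodule)
    {ι : Type*} [Fintype ι] {a : ι → X} (ha : ∑ i, a i * star (a i) ∈ S) {R : Submodule ℂ X}
    {k : ι} (hR : ∀ u ∈ S, u * a k ∈ R) : a k ∈ weakClosure (xDual F) R := by
  obtain ⟨l, _, hl, hunit⟩ := exists_approximateUnit S (isClosed_of_weakClosure_le hS)
  exact mem_weakClosure_of_tendsto (fun _ => continuous_of_mem_xDual)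
    (hl.mono fun u hu => hR u hu) (hunit _ ha _ (Finset.single_le_sum
      (f := fun i => a i * star (a i)) (fun i _ => mul_star_self_nonneg (a i)) (Finset.mem_univ k)))

end Hereditary

section InvariantHereditary

variable {X : Type*} [NonUnitalCStarAlgebra X] {F : Submodule ℂ (StrongDual ℂ X)}

lemma weakClosure_top_le : weakClosure (xDual F) (⊤ : NonUnitalStarSubalgebra ℂ X).toSubmodule ≤
    (⊤ : NonUnitalStarSubalgebra ℂ X).toSubmodule := fun _ _ => trivial

lemma weakClosure_inf_le {A B : NonUnitalStarSubalgebra ℂ X}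
    (hA : weakClosure (xDual F) A.toSubmodule ≤ A.toSubmodule)
    (hB : weakClosure (xDual F) B.toSubmodule ≤ B.toSubmodule) :
    weakClosure (xDual F) (A ⊓ B).toSubmodule ≤ (A ⊓ B).toSubmodule := fun _ hx =>
  ⟨hA (weakClosure_le_weakClosure (S := (A ⊓ B).toSubmodule)
      (fun _ hs => le_weakClosure _ _ hs.1) hx),
    hB (weakClosure_le_weakClosure (S := (A ⊓ B).toSubmodule)
      (fun _ hs => le_weakClosure _ _ hs.2) hx)⟩

variable [PartialOrder X] {G : Type*} [Group G] {α : G →* (X ≃⋆ₐ[ℂ] X)}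

lemma isInvariantHereditary_top [Nontrivial X] : IsInvariantHereditary F α ⊤ where
  ne_bot := (exists_ne (0 : X)).imp fun _ h => ⟨trivial, h⟩
  isClosed :=
    (isClosed_fTopology_iff (⊤ : NonUnitalStarSubalgebra ℂ X).toSubmodule).2 weakClosure_top_le
  invariant _ _ _ := trivial
  hereditary _ _ _ _ _ := trivial

lemma IsInvariantHereditary.weakClosure_le {Y : NonUnitalStarSubalgebra ℂ X}
    (hY : IsInvariantHereditary F α Y) : weakClosure (xDual F) Y.toSubmodule ≤ Y.toSubmodule :=
  (isClosed_fTopology_iff Y.toSubmodule).1 hY.isClosed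

end InvariantHereditary

section FixedPoints

variable {X : Type*} [NonUnitalCStarAlgebra X]
  {G : Type*} [Group G] [TopologicalSpace G]
  {F : Submodule ℂ (StrongDual ℂ X)} {α : G →* (X ≃⋆ₐ[ℂ] X)}

lemma exists_rep_mat_eq_one (G : Type*) [Group G] [TopologicalSpace G] :
    ∃ c : DualSet G, ∀ g, c.rep.mat g = 1 := by
  let trivialRep : IrrRep G :=
    { dim := 1
      dim_pos := one_pos
      rep := 1
      continuous_rep := continuous_const
      irreducible := fun W _ => by
        have := is_simple_module_of_finrank_eq_one (K := ℂ) (A := ℂ) (V := Fin 1 → ℂ) (by simp)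
        exact eq_bot_or_eq_top W }
  let c : DualSet G := Quotient.mk _ trivialRep
  obtain ⟨U, hU, -, hequiv⟩ : IrrRep.UnitarilyEquiv c.rep trivialRep :=
    Quotient.mk_out (s := irrRepSetoid G) trivialRep
  refine ⟨c, fun g => ?_⟩
  have hmat : U * c.rep.mat g = U := (hequiv g).trans (Matrix.one_mul U)
  rw [← Matrix.one_mul (c.rep.mat g), ← hU, Matrix.mul_assoc, hmat]

lemma isRow_const {π : IrrRep G} (hπ : ∀ g, π.mat g = 1) {s : X} (hs : s ∈ fixedPts α) :
    IsRow α π (fun _ => s) := by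
  intro g k
  simp [hπ, hs g, Matrix.one_apply, ite_smul]

lemma mem_fixedAlgebra_of_mat_eq_one {π : IrrRep G} (hπ : ∀ g, π.mat g = 1)
    {c : Matrix (Fin π.dim) (Fin π.dim) X} :
    c ∈ fixedAlgebra α ⊤ π ↔ ∀ i j, c i j ∈ fixedPts α := by
  rw [mem_fixedAlgebra]
  simp only [hπ, Matrix.one_apply]
  constructor
  · intro h i j g
    simpa [ite_and] using h.2 g i j
  · intro h
    exact ⟨fun _ _ => trivial, fun g i j => by simpa [ite_and] using h i j g⟩

lemma diagonal_mem_fixedAlgebra {Y : NonUnitalStarSubalgebra ℂ X} {s : X}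
    (hs : s ∈ Y ⊓ fixedPts α) (π : IrrRep G) :
    Matrix.diagonal (fun _ => s) ∈ fixedAlgebra α Y π := by
  refine mem_fixedAlgebra.2 ⟨fun i j => ?_, fun g i j => ?_⟩
  · rw [Matrix.diagonal_apply]
    split_ifs
    exacts [hs.1, zero_mem Y]
  · simp only [Matrix.diagonal_apply, smul_ite, smul_zero, Finset.sum_ite_eq, Finset.mem_univ,
      if_true, ← Finset.sum_smul, sum_star_mat_mul_mat π g i j]
    split_ifs
    · rw [hs.2 g, one_smul]
    · simp

/-- `F`-simplicity of the fixed point algebra of `α`, which is the case of the trivial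
representation in condition (i) of the theorem. -/
def IsFixedPtsSimple (F : Submodule ℂ (StrongDual ℂ X)) (α : G →* (X ≃⋆ₐ[ℂ] X)) : Prop :=
  ∀ I : Submodule ℂ X, I ≠ ⊥ → I ≤ (fixedPts α).toSubmodule →
    (∀ x ∈ I, ∀ b ∈ fixedPts α, b * x ∈ I ∧ x * b ∈ I) →
    (fixedPts α).toSubmodule ≤ weakClosure (xDual F) I

lemma IsFixedPtsSimple.of_isFSimple {π : IrrRep G} (hπ : ∀ g, π.mat g = 1)
    (h : IsFSimple F (fixedAlgebra α ⊤ π)) : IsFixedPtsSimple F α := by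
  intro I hI hIfix hmul x hx
  let M : Submodule ℂ (Matrix (Fin π.dim) (Fin π.dim) X) :=
    { carrier := {a | ∀ i j, a i j ∈ I}
      add_mem' := fun ha hb i j => add_mem (ha i j) (hb i j)
      zero_mem' := fun _ _ => zero_mem I
      smul_mem' := fun c a ha i j => I.smul_mem c (ha i j) }
  let i₀ : Fin π.dim := ⟨0, π.dim_pos⟩
  have hM : M ≠ ⊥ := by
    obtain ⟨y, hy, hy0⟩ := Submodule.exists_mem_ne_zero_of_ne_bot hI
    exact (Submodule.ne_bot_iff M).2
      ⟨of fun _ _ => y, fun _ _ => hy, fun h => hy0 (congrFun (congrFun h i₀) i₀)⟩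
  have hmulM (a) (ha : a ∈ M) (b) (hb : b ∈ fixedAlgebra α ⊤ π) : b * a ∈ M ∧ a * b ∈ M := by
    rw [mem_fixedAlgebra_of_mat_eq_one hπ] at hb
    refine ⟨fun i j => ?_, fun i j => ?_⟩ <;> rw [Matrix.mul_apply]
    · exact sum_mem fun k _ => (hmul _ (ha k j) _ (hb i k)).1
    · exact sum_mem fun k _ => (hmul _ (ha i k) _ (hb k j)).2
  have hdense := h M hM
    (fun a ha => (mem_fixedAlgebra_of_mat_eq_one hπ).2 fun i j => hIfix (ha i j)) hmulM
  rw [closure_matTopology] at hdense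
  exact (weaklyContinuous_entry i₀ i₀).map_mem (S := M)
    (fun s hs => le_weakClosure _ _ (hs i₀ i₀))
    (hdense (a := of fun _ _ => x) ((mem_fixedAlgebra_of_mat_eq_one hπ).2 fun _ _ => hx))

lemma mem_strongConnesSpectrum_iff [PartialOrder X] (hF : IsCStarDualPair F)
    (hα : IsFDynamicalSystem F α) {c : DualSet G} :
    c ∈ strongConnesSpectrum F α ↔ ∀ Y, IsInvariantHereditary F α Y →
      (fixedAlgebra α Y c.rep).toSubmodule ≤
        weakClosure (matDual F _) (spectralIdeal α Y c.rep) := by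
  refine forall₂_congr fun Y hY => ?_
  rw [strongArvesonSpectrum, Set.mem_ofPred_eq, closure_matTopology]
  refine ⟨fun h x hx => h.ge hx, fun h => subset_antisymm ?_ h⟩
  exact (weakClosure_le_weakClosure ((spectralIdeal_le _ _).trans (le_weakClosure _ _))).trans
    (weakClosure_fixedAlgebra_le hF hα hY.weakClosure_le _)

end FixedPoints

section FixedPointDensity

variable {X : Type*} [NonUnitalCStarAlgebra X] [PartialOrder X] [StarOrderedRing X]
  {G : Type*} [Group G] [TopologicalSpace G] [IsTopologicalGroup G] [CompactSpace G]
  [MeasurableSpace G] [BorelSpace G]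
  {F : Submodule ℂ (StrongDual ℂ X)} {α : G →* (X ≃⋆ₐ[ℂ] X)}

lemma exists_fixedPts_ne_zero (hF : IsCStarDualPair F) (hα : IsFDynamicalSystem F α)
    {Y : Submodule ℂ X} (hY : weakClosure (xDual F) Y ≤ Y) (hinv : ∀ g, ∀ y ∈ Y, α g y ∈ Y)
    (hmul : ∀ x ∈ Y, ∀ y ∈ Y, x * star y ∈ Y) (hne : ∃ y ∈ Y, y ≠ 0) :
    ∃ s ∈ Y, s ∈ fixedPts α ∧ s ≠ 0 := by
  obtain ⟨c, a, ha, haY, k, hk⟩ := exists_row_ne_zero hF hα hY hinv hne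
  exact ⟨_, sum_mem fun k _ => hmul _ (haY k) _ (haY k), ha.sum_mul_star_mem ha,
    sum_mul_star_ne_zero hk⟩

lemma IsInvariantHereditary.exists_fixedPts_ne_zero (hF : IsCStarDualPair F)
    (hα : IsFDynamicalSystem F α) {Y : NonUnitalStarSubalgebra ℂ X}
    (hY : IsInvariantHereditary F α Y) : ∃ s ∈ Y ⊓ fixedPts α, s ≠ 0 := by
  obtain ⟨s, hsY, hsfix, hs0⟩ := FDyn.exists_fixedPts_ne_zero hF hα hY.weakClosure_le hY.invariant
    (fun _ hx _ hy => Y.mul_mem hx (star_mem (s := Y) hy)) hY.ne_bot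
  exact ⟨s, ⟨hsY, hsfix⟩, hs0⟩

lemma le_weakClosure_fixedPts_mul (hF : IsCStarDualPair F) (hα : IsFDynamicalSystem F α)
    {Y : NonUnitalStarSubalgebra ℂ X} (hY : weakClosure (xDual F) Y.toSubmodule ≤ Y.toSubmodule)
    (hinv : ∀ g, ∀ y ∈ Y, α g y ∈ Y) : Y.toSubmodule ≤
      weakClosure (xDual F) (Submodule.span ℂ {z | ∃ u ∈ Y ⊓ fixedPts α, ∃ x ∈ Y, z = u * x}) := by
  intro x hx
  refine mem_weakClosure_of_rows hF hα hY hinv (fun c a ha haY k => ?_) hx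
  exact mem_weakClosure_of_sum_mul_star_mem (weakClosure_inf_le hY (weakClosure_fixedPts_le hF hα))
    ⟨sum_mem fun k _ => mul_mem (haY k) (star_mem (haY k)), ha.sum_mul_star_mem ha⟩
    fun u hu => Submodule.subset_span ⟨u, hu, _, haY k, rfl⟩

lemma le_weakClosure_fixedPts_mul_mul (hF : IsCStarDualPair F) (hα : IsFDynamicalSystem F α)
    {Y : NonUnitalStarSubalgebra ℂ X} (hY : weakClosure (xDual F) Y.toSubmodule ≤ Y.toSubmodule)
    (hinv : ∀ g, ∀ y ∈ Y, α g y ∈ Y) : Y.toSubmodule ≤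
      weakClosure (xDual F) (Submodule.span ℂ
        {z | ∃ u ∈ Y ⊓ fixedPts α, ∃ v ∈ Y ⊓ fixedPts α, ∃ x, z = u * x * v}) := by
  have hleft := le_weakClosure_fixedPts_mul hF hα hY hinv
  refine hleft.trans (weakClosure_le_weakClosure (Submodule.span_le.2 ?_))
  rintro _ ⟨u, hu, x, hx, rfl⟩
  have hright : star (star x) ∈ weakClosure (xDual F)
      (Submodule.span ℂ {z | ∃ v ∈ Y ⊓ fixedPts α, ∃ x, z = x * v}) := by
    refine hF.star_mem_weakClosure_span ?_ (hleft (star_mem hx : star x ∈ Y))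
    rintro _ ⟨v, hv, y, -, rfl⟩
    exact le_weakClosure _ _ (Submodule.subset_span ⟨star v, star_mem hv, star y, star_mul _ _⟩)
  rw [star_star] at hright
  refine (hF.weaklyContinuous_mul_left u).map_mem_span ?_ hright
  rintro _ ⟨v, hv, y, rfl⟩
  exact le_weakClosure _ _ (Submodule.subset_span ⟨u, hu, v, hv, y, (mul_assoc _ _ _).symm⟩)

lemma IsFixedPtsSimple.isAlphaSimple (hF : IsCStarDualPair F) (hα : IsFDynamicalSystem F α)
    (h : IsFixedPtsSimple F α) : IsAlphaSimple F α := by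
  intro I hI hmul hinv
  rw [closure_fTopology]
  set J := weakClosure (xDual F) I
  have hJcl : weakClosure (xDual F) J ≤ J := weakClosure_weakClosure_le _ _
  have hJmul (x : X) (hx : x ∈ J) (b : X) : b * x ∈ J ∧ x * b ∈ J :=
    ⟨(hF.weaklyContinuous_mul_left b).map_mem (fun s hs => le_weakClosure _ _ (hmul s hs b).1) hx,
      (hF.weaklyContinuous_mul_right b).map_mem (fun s hs => le_weakClosure _ _ (hmul s hs b).2) hx⟩
  have hJinv (g : G) (y : X) (hy : y ∈ J) : α g y ∈ J :=
    (hα.weaklyContinuous g).map_mem (fun s hs => le_weakClosure _ _ (hinv g s hs)) hy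
  obtain ⟨y, hy, hy0⟩ := Submodule.exists_mem_ne_zero_of_ne_bot hI
  obtain ⟨s, hsJ, hsfix, hs0⟩ := exists_fixedPts_ne_zero hF hα hJcl hJinv
    (fun x hx y _ => (hJmul x hx _).2) ⟨y, le_weakClosure _ _ hy, hy0⟩
  have hfixJ : (fixedPts α).toSubmodule ≤ J := by
    refine (h (J ⊓ (fixedPts α).toSubmodule) ?_ inf_le_right fun x hx b hb => ?_).trans
      ((weakClosure_le_weakClosure (inf_le_left.trans (le_weakClosure _ _))).trans hJcl)
    · exact (Submodule.ne_bot_iff _).2 ⟨s, ⟨hsJ, hsfix⟩, hs0⟩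
    · exact ⟨⟨(hJmul x hx.1 b).1, (fixedPts α).mul_mem hb hx.2⟩,
        ⟨(hJmul x hx.1 b).2, (fixedPts α).mul_mem hx.2 hb⟩⟩
  refine Set.eq_univ_of_forall fun x => hJcl ?_
  refine mem_weakClosure_of_rows hF hα (weakClosure_top_le (X := X)) (fun _ _ _ => trivial)
    (fun c a ha _ k => ?_) (x := x) trivial
  exact mem_weakClosure_of_sum_mul_star_mem (weakClosure_fixedPts_le hF hα)
    (ha.sum_mul_star_mem ha) fun u hu => (hJmul u (hfixJ hu) _).2

lemma strongConnesSpectrum_subset [Nontrivial X] (hF : IsCStarDualPair F)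
    (hα : IsFDynamicalSystem F α) : strongConnesSpectrum F α ⊆ spectrumOf F α := by
  intro c hc
  rw [mem_spectrumOf_iff hF hα]
  by_contra! hcon
  have hdense := (mem_strongConnesSpectrum_iff hF hα).1 hc ⊤ isInvariantHereditary_top
  have hbot : spectralIdeal α ⊤ c.rep = ⊥ := by
    rw [spectralIdeal_eq_span, Submodule.span_eq_bot]
    rintro _ ⟨a, b, ha, -, -, -, rfl⟩
    ext k l
    simp [outer, vecMulVec_apply, hcon a ha]
  rw [hbot, hF.weakClosure_matDual_bot] at hdense
  obtain ⟨s, hs, hs0⟩ := (isInvariantHereditary_top (F := F) (α := α)).exists_fixedPts_ne_zero hF hα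
  have hdiag := (Submodule.mem_bot ℂ).1 (hdense (diagonal_mem_fixedAlgebra hs c.rep))
  let i₀ : Fin c.rep.dim := ⟨0, c.rep.dim_pos⟩
  exact hs0 (by simpa using congrFun (congrFun hdiag i₀) i₀)

end FixedPointDensity

/-! ### The strong Connes spectrum -/

section RowIdeals

lemma mul_mem_span_of_mul_mem {R : Type*} [NonUnitalRing R] [Module ℂ R] [IsScalarTower ℂ R R]
    [SMulCommClass ℂ R R] {A B : Set R}
    (h : ∀ x ∈ A, ∀ b ∈ B, b * x ∈ Submodule.span ℂ A ∧ x * b ∈ Submodule.span ℂ A) :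
    ∀ x ∈ Submodule.span ℂ A, ∀ b ∈ B,
      b * x ∈ Submodule.span ℂ A ∧ x * b ∈ Submodule.span ℂ A := fun _ hx b hb =>
  ⟨(Submodule.span_le (p := (Submodule.span ℂ A).comap (LinearMap.mulLeft ℂ b))).2
      (fun s hs => (h s hs b hb).1) hx,
    (Submodule.span_le (p := (Submodule.span ℂ A).comap (LinearMap.mulRight ℂ b))).2
      (fun s hs => (h s hs b hb).2) hx⟩

lemma mul_vecMul {R ι : Type*} [NonUnitalSemiring R] [Fintype ι] (u : R) (a : ι → R)
    (c : Matrix ι ι R) : (fun k => u * a k) ᵥ* c = fun k => u * (a ᵥ* c) k := by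
  ext k
  simp [Matrix.vecMul, dotProduct, Finset.mul_sum, mul_assoc]

variable {X : Type*} [NonUnitalCStarAlgebra X]

lemma outer_self_ne_zero {n : ℕ} {a : Fin n → X} {k : Fin n} (hk : a k ≠ 0) : outer a a ≠ 0 :=
  fun h => hk ((CStarRing.star_mul_self_eq_zero_iff _).1 (congrFun (congrFun h k) k))

variable {G : Type*} [Group G] [TopologicalSpace G]
  {F : Submodule ℂ (StrongDual ℂ X)} {α : G →* (X ≃⋆ₐ[ℂ] X)}

/-- The linear span of the products `∑ₖ pₖ bₖ*` of a row `p ∈ P` and the adjoint of a row `b` of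
`X₂(π)`. It is an ideal of the fixed point algebra if `P` consists of rows of `X₂(π)` and is
invariant under multiplication from the left by fixed points. -/
def rowProducts (α : G →* (X ≃⋆ₐ[ℂ] X)) (π : IrrRep G) (P : Set (Fin π.dim → X)) :
    Submodule ℂ X :=
  Submodule.span ℂ {z | ∃ p ∈ P, ∃ b, IsRow α π b ∧ z = ∑ k, p k * star (b k)}

/-- The linear span of the products `(u a)* (v b)` of rows `a, b` of `X₂(π)` and fixed points
`u, v` in `Y`, an ideal of `(X ⊗ B(H_π))^{α ⊗ ad π}`. -/
def cornerIdeal (α : G →* (X ≃⋆ₐ[ℂ] X)) (Y : NonUnitalStarSubalgebra ℂ X) (π : IrrRep G) :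
    Submodule ℂ (Matrix (Fin π.dim) (Fin π.dim) X) :=
  Submodule.span ℂ {z | ∃ a b, IsRow α π a ∧ IsRow α π b ∧
    ∃ u ∈ Y ⊓ fixedPts α, ∃ v ∈ Y ⊓ fixedPts α, z = outer (fun k => u * a k) fun k => v * b k}

lemma le_weakClosure_cornerIdeal {Y : NonUnitalStarSubalgebra ℂ X} {π : IrrRep G}
    (h : IsFSimple F (fixedAlgebra α ⊤ π)) {a : Fin π.dim → X} (ha : IsRow α π a) {u : X}
    (hu : u ∈ Y ⊓ fixedPts α) {k : Fin π.dim} (hk : u * a k ≠ 0) :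
    (fixedAlgebra α ⊤ π).toSubmodule ≤ weakClosure (matDual F π.dim) (cornerIdeal α Y π) := by
  have hle : cornerIdeal α Y π ≤ (fixedAlgebra α ⊤ π).toSubmodule := by
    refine Submodule.span_le.2 ?_
    rintro _ ⟨a, b, ha, hb, u, hu, v, hv, rfl⟩
    exact (ha.mul_left hu.2).outer_mem (hb.mul_left hv.2) (fun _ => trivial) fun _ => trivial
  have hdense := h (cornerIdeal α Y π) ?_ (fun _ hx => hle hx)
    (mul_mem_span_of_mul_mem
      (B := (fixedAlgebra α ⊤ π : Set (Matrix (Fin π.dim) (Fin π.dim) X))) ?_)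
  · rwa [closure_matTopology] at hdense
  · exact (Submodule.ne_bot_iff _).2 ⟨_, Submodule.subset_span
      ⟨a, a, ha, ha, u, hu, u, hu, rfl⟩, outer_self_ne_zero (a := fun k => u * a k) hk⟩
  · rintro _ ⟨a, b, ha, hb, u, hu, v, hv, rfl⟩ c hc
    rw [mul_outer, outer_mul, mul_vecMul, mul_vecMul]
    exact ⟨Submodule.subset_span ⟨_, b, ha.vecMul (star_mem hc), hb, u, hu, v, hv, rfl⟩,
      Submodule.subset_span ⟨a, _, ha, hb.vecMul hc, u, hu, v, hv, rfl⟩⟩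

variable [PartialOrder X] [StarOrderedRing X]

lemma IsFixedPtsSimple.le_weakClosure_rowProducts (h : IsFixedPtsSimple F α) {π : IrrRep G}
    {P : Set (Fin π.dim → X)} (hP : ∀ p ∈ P, IsRow α π p)
    (hmul : ∀ p ∈ P, ∀ y ∈ fixedPts α, (fun k => y * p k) ∈ P) (hne : ∃ p ∈ P, ∃ k, p k ≠ 0) :
    (fixedPts α).toSubmodule ≤ weakClosure (xDual F) (rowProducts α π P) := by
  refine h _ ?_ ?_ (mul_mem_span_of_mul_mem (B := (fixedPts α : Set X)) ?_)
  · obtain ⟨p, hp, k, hk⟩ := hne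
    exact (Submodule.ne_bot_iff _).2
      ⟨_, Submodule.subset_span ⟨p, hp, p, hP p hp, rfl⟩, sum_mul_star_ne_zero hk⟩
  · refine Submodule.span_le.2 ?_
    rintro _ ⟨p, hp, b, hb, rfl⟩
    exact (hP p hp).sum_mul_star_mem hb
  · rintro _ ⟨p, hp, b, hb, rfl⟩ y hy
    refine ⟨Submodule.subset_span ⟨_, hmul p hp y hy, b, hb, ?_⟩,
      Submodule.subset_span ⟨p, hp, _, hb.mul_left (star_mem hy), ?_⟩⟩
    · simp only [Finset.mul_sum, mul_assoc]
    · simp only [Finset.sum_mul, mul_assoc, star_mul, star_star]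

lemma IsFixedPtsSimple.exists_mul_row_ne_zero (hF : IsCStarDualPair F)
    (h : IsFixedPtsSimple F α) {π : IrrRep G} (hne : ∃ a, IsRow α π a ∧ ∃ k, a k ≠ 0) {s : X}
    (hs : s ∈ fixedPts α) (hs0 : s ≠ 0) : ∃ a, IsRow α π a ∧ ∃ k, s * a k ≠ 0 := by
  by_contra! hcon
  have hdense := h.le_weakClosure_rowProducts (P := {a | IsRow α π a}) (fun _ ha => ha)
    (fun _ ha _ hy => ha.mul_left hy) hne
  have hbot : s * star s ∈ weakClosure (xDual F) (⊥ : Submodule ℂ X) := by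
    refine (hF.weaklyContinuous_mul_left s).map_mem_span ?_
      (hdense (star_mem hs : star s ∈ fixedPts α))
    rintro _ ⟨a, ha, b, -, rfl⟩
    simp only [Finset.mul_sum, ← mul_assoc, hcon a ha, zero_mul, Finset.sum_const_zero]
    exact zero_mem _
  rw [hF.weakClosure_bot, Submodule.mem_bot] at hbot
  exact hs0 ((CStarRing.mul_star_self_eq_zero_iff _).1 hbot)

end RowIdeals

section StrongConnesSpectrum

variable {X : Type*} [NonUnitalCStarAlgebra X] {F : Submodule ℂ (StrongDual ℂ X)}

lemma IsCStarDualPair.weaklyContinuous_map_mul_mul (hF : IsCStarDualPair F) {n : ℕ} (u v : X) :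
    WeaklyContinuous (matDual F n) (matDual F n)
      (fun c : Matrix (Fin n) (Fin n) X => c.map fun x => u * x * v) :=
  .of_entries fun i j => (hF.weaklyContinuous_mul_right v).comp
    ((hF.weaklyContinuous_mul_left u).comp (weaklyContinuous_entry i j))

variable {G : Type*} [Group G] [TopologicalSpace G] {α : G →* (X ≃⋆ₐ[ℂ] X)}

lemma map_mul_mul_mem_weakClosure_spectralIdeal [PartialOrder X] [StarOrderedRing X]
    (hF : IsCStarDualPair F) {Y : NonUnitalStarSubalgebra ℂ X}
    (hY : ∀ x y : X, 0 ≤ x → x ≤ y → y ∈ Y → x ∈ Y) {π : IrrRep G} {u v : X}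
    (hu : u ∈ Y ⊓ fixedPts α) (hv : v ∈ Y ⊓ fixedPts α) {c : Matrix (Fin π.dim) (Fin π.dim) X}
    (hc : c ∈ weakClosure (matDual F π.dim) (cornerIdeal α Y π)) :
    (c.map fun x => u * x * v) ∈ weakClosure (matDual F π.dim) (spectralIdeal α Y π) := by
  refine (hF.weaklyContinuous_map_mul_mul u v).map_mem_span ?_ hc
  rintro _ ⟨a, b, ha, hb, y, hy, z, hz, rfl⟩
  rw [spectralIdeal_eq_span]
  refine le_weakClosure _ _ (Submodule.subset_span
    ⟨fun k => y * a k * star u, fun k => z * b k * v,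
      (ha.mul_left hy.2).mul_right (star_mem hu.2), (hb.mul_left hz.2).mul_right hv.2,
      fun _ => mul_mul_mem_of_hereditary hY hy.1 _ (star_mem hu.1),
      fun _ => mul_mul_mem_of_hereditary hY hz.1 _ hv.1, ?_⟩)
  ext i j
  simp [outer, vecMulVec_apply, mul_assoc]

variable [IsTopologicalGroup G] [CompactSpace G] [MeasurableSpace G] [BorelSpace G]

lemma tensorAvg_mul_mul (hF : IsCStarDualPair F) (hα : IsFDynamicalSystem F α) (π : IrrRep G)
    (k l : Fin π.dim) {u v : X} (hu : u ∈ fixedPts α) (hv : v ∈ fixedPts α) (x : X) :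
    tensorAvg F α π k l (u * x * v) = (tensorAvg F α π k l x).map fun y => u * y * v := by
  have hc := continuous_mat_mul_star_mat π
  ext i j
  simp only [tensorAvg, of_apply, Matrix.map_apply]
  rw [avg_mul hF hα (hc _ _ _ _) hv, mul_avg hF hα (hc _ _ _ _) hu]

variable [PartialOrder X] [StarOrderedRing X]

lemma IsFixedPtsSimple.mem_strongConnesSpectrum (hF : IsCStarDualPair F)
    (hα : IsFDynamicalSystem F α) (h : IsFixedPtsSimple F α) {c : DualSet G}
    (hc : c ∈ spectrumOf F α) (hsimple : IsFSimple F (fixedAlgebra α ⊤ c.rep)) :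
    c ∈ strongConnesSpectrum F α := by
  refine (mem_strongConnesSpectrum_iff hF hα).2 fun Y hY M hM => ?_
  obtain ⟨s, hs, hs0⟩ := hY.exists_fixedPts_ne_zero hF hα
  obtain ⟨a, ha, k, hk⟩ :=
    h.exists_mul_row_ne_zero hF ((mem_spectrumOf_iff hF hα).1 hc) hs.2 hs0
  have hdense := le_weakClosure_cornerIdeal hsimple ha hs hk
  rw [← sum_tensorAvg hF hα hM]
  refine sum_mem fun k _ => sum_mem fun l _ => ?_
  refine (weaklyContinuous_tensorAvg hF hα c.rep k l).map_mem_span ?_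
    (le_weakClosure_fixedPts_mul_mul hF hα hY.weakClosure_le hY.invariant
      ((mem_fixedAlgebra.1 hM).1 k l))
  rintro _ ⟨u, hu, v, hv, x, rfl⟩
  rw [tensorAvg_mul_mul hF hα c.rep k l hu.2 hv.2]
  exact map_mul_mul_mem_weakClosure_spectralIdeal hF hY.hereditary hu hv
    (hdense (tensorAvg_mem hF hα c.rep k l x))

end StrongConnesSpectrum

/-! ### Simplicity of the fixed point algebras -/

section FixedAlgebraSimple

variable {X : Type*} [NonUnitalCStarAlgebra X] {F : Submodule ℂ (StrongDual ℂ X)}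

lemma outer_mul_outer {n : ℕ} (d a b e : Fin n → X) :
    outer d a * outer b e = outer d (fun l => (∑ k, a k * star (b k)) * e l) := by
  ext i j
  simp [outer, vecMulVec_apply, Matrix.mul_apply, Finset.sum_mul, Finset.mul_sum, mul_assoc]

lemma IsCStarDualPair.weaklyContinuous_matrix_mul_right (hF : IsCStarDualPair F) {n : ℕ}
    (m : Matrix (Fin n) (Fin n) X) :
    WeaklyContinuous (matDual F n) (matDual F n) (fun a : Matrix (Fin n) (Fin n) X => a * m) :=
  .of_entries fun i j => by
    simp only [Matrix.mul_apply]
    exact .sum fun k _ => (hF.weaklyContinuous_mul_right _).comp (weaklyContinuous_entry i k)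

lemma IsCStarDualPair.weaklyContinuous_outer_mul (hF : IsCStarDualPair F) {n : ℕ}
    (d e : Fin n → X) :
    WeaklyContinuous (xDual F) (matDual F n) (fun y => outer d (fun l => y * e l)) :=
  .of_entries fun i j =>
    (hF.weaklyContinuous_mul_left (star (d i))).comp (hF.weaklyContinuous_mul_right (e j))

variable {G : Type*} [Group G] [TopologicalSpace G] {α : G →* (X ≃⋆ₐ[ℂ] X)} {π : IrrRep G}
  {J : Submodule ℂ (Matrix (Fin π.dim) (Fin π.dim) X)}

lemma outer_mul_mem_weakClosure (hF : IsCStarDualPair F)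
    (hJ : ∀ m ∈ J, ∀ c ∈ fixedAlgebra α ⊤ π, c * m ∈ J ∧ m * c ∈ J) {d e : Fin π.dim → X}
    (hd : IsRow α π d) (he : IsRow α π e) {y : X} (hy : y ∈ weakClosure (xDual F)
      (rowProducts α π {p | ∃ a, IsRow α π a ∧ ∃ m ∈ J, p = a ᵥ* m})) :
    outer d (fun l => y * e l) ∈ weakClosure (matDual F π.dim) J := by
  refine (hF.weaklyContinuous_outer_mul d e).map_mem_span ?_ hy
  rintro _ ⟨_, ⟨a, ha, m, hm, rfl⟩, b, hb, rfl⟩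
  rw [← outer_mul_outer, ← outer_mul]
  have hleft : outer d a * m ∈ J :=
    (hJ _ hm _ (hd.outer_mem ha (fun _ => trivial) fun _ => trivial)).1
  exact le_weakClosure _ _
    (hJ _ hleft _ (hb.outer_mem he (fun _ => trivial) fun _ => trivial)).2

variable [PartialOrder X] [StarOrderedRing X]

lemma eq_zero_of_conjTranspose_mul_self {n : ℕ} {m : Matrix (Fin n) (Fin n) X}
    (h : mᴴ * m = 0) : m = 0 := by
  ext k i
  have hdiag : ∑ j, star (m j i) * m j i = 0 := congrFun (congrFun h i) i
  exact (CStarRing.star_mul_self_eq_zero_iff _).1 <|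
    (Finset.sum_eq_zero_iff_of_nonneg fun j _ => star_mul_self_nonneg (m j i)).1 hdiag k
      (Finset.mem_univ k)

lemma IsRow.outer_mem_weakClosure (hF : IsCStarDualPair F) (hα : IsFDynamicalSystem F α)
    {d e : Fin π.dim → X} (he : IsRow α π e)
    (h : ∀ y ∈ fixedPts α, outer d (fun l => y * e l) ∈ weakClosure (matDual F π.dim) J) :
    outer d e ∈ weakClosure (matDual F π.dim) J := by
  obtain ⟨l, _, hl, hunit⟩ :=
    exists_approximateUnit (fixedPts α) (isClosed_of_weakClosure_le (weakClosure_fixedPts_le hF hα))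
  refine weakClosure_weakClosure_le _ _ (mem_weakClosure_of_tendsto
    (fun _ => continuous_of_mem_matDual) (hl.mono h)
    (tendsto_pi_nhds.2 fun i => tendsto_pi_nhds.2 fun j => ?_))
  exact (hunit _ (he.sum_mul_star_mem he) (e j) (Finset.single_le_sum
    (f := fun i => e i * star (e i)) (fun i _ => mul_star_self_nonneg (e i))
    (Finset.mem_univ j))).const_mul (star (d i))

variable [Nontrivial X] {c : DualSet G}

lemma eq_zero_of_vecMul_eq_zero (hF : IsCStarDualPair F) (hα : IsFDynamicalSystem F α)
    (hc : c ∈ strongConnesSpectrum F α) {m : Matrix (Fin c.rep.dim) (Fin c.rep.dim) X}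
    (hm : m ∈ fixedAlgebra α ⊤ c.rep) (h : ∀ a, IsRow α c.rep a → a ᵥ* m = 0) : m = 0 := by
  have hdense := (mem_strongConnesSpectrum_iff hF hα).1 hc ⊤ isInvariantHereditary_top
  rw [spectralIdeal_eq_span] at hdense
  have hbot : mᴴ * m ∈ weakClosure (matDual F _) ⊥ := by
    refine (hF.weaklyContinuous_matrix_mul_right m).map_mem_span ?_
      (hdense (star_mem hm : mᴴ ∈ fixedAlgebra α ⊤ c.rep))
    rintro _ ⟨a, b, -, hb, -, -, rfl⟩
    rw [outer_mul, h b hb, outer, vecMulVec_zero]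
    exact zero_mem _
  rw [hF.weakClosure_matDual_bot, Submodule.mem_bot] at hbot
  exact eq_zero_of_conjTranspose_mul_self hbot

lemma IsFixedPtsSimple.isFSimple (hF : IsCStarDualPair F) (hα : IsFDynamicalSystem F α)
    (h : IsFixedPtsSimple F α) (hc : c ∈ strongConnesSpectrum F α) :
    IsFSimple F (fixedAlgebra α ⊤ c.rep) := by
  intro J hJ hJB hJmul
  have hrows : (fixedPts α).toSubmodule ≤ weakClosure (xDual F)
      (rowProducts α c.rep {p | ∃ a, IsRow α c.rep a ∧ ∃ m ∈ J, p = a ᵥ* m}) := by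
    refine h.le_weakClosure_rowProducts ?_ ?_ ?_
    · rintro _ ⟨a, ha, m, hm, rfl⟩
      exact ha.vecMul (hJB m hm)
    · rintro _ ⟨a, ha, m, hm, rfl⟩ y hy
      exact ⟨_, ha.mul_left hy, m, hm, (mul_vecMul y a m).symm⟩
    · obtain ⟨m, hm, hm0⟩ := Submodule.exists_mem_ne_zero_of_ne_bot hJ
      by_contra! hzero
      exact hm0 (eq_zero_of_vecMul_eq_zero hF hα hc (hJB m hm) fun a ha =>
        funext (hzero _ ⟨a, ha, m, hm, rfl⟩))
  rw [closure_matTopology]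
  refine ((mem_strongConnesSpectrum_iff hF hα).1 hc ⊤ isInvariantHereditary_top).trans
    (weakClosure_le_weakClosure ?_)
  rw [spectralIdeal_eq_span, Submodule.span_le]
  rintro _ ⟨d, e, hd, he, -, -, rfl⟩
  exact he.outer_mem_weakClosure hF hα fun y hy =>
    outer_mul_mem_weakClosure hF hJmul hd he (hrows hy)

end FixedAlgebraSimple

section HereditarySubalgebra

variable {X : Type*} [NonUnitalCStarAlgebra X] {F : Submodule ℂ (StrongDual ℂ X)}

/-- The linear span `J X J*` of the products `j₁ x j₂*` with `j₁, j₂ ∈ J` and `x ∈ X`. -/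
def sandwich (J : Submodule ℂ X) : Submodule ℂ X :=
  Submodule.span ℂ {z | ∃ j₁ ∈ J, ∃ j₂ ∈ J, ∃ x, z = j₁ * x * star j₂}

lemma mul_mul_star_mem_sandwich {J : Submodule ℂ X} {j₁ j₂ : X} (hj₁ : j₁ ∈ J) (x : X)
    (hj₂ : j₂ ∈ J) : j₁ * x * star j₂ ∈ sandwich J :=
  Submodule.subset_span ⟨j₁, hj₁, j₂, hj₂, x, rfl⟩

/-- The `F`-closure of `J X J*`, the `F`-closed hereditary subalgebra generated by `J`. -/
def hereditarySubalgebra (hF : IsCStarDualPair F) (J : Submodule ℂ X) :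
    NonUnitalStarSubalgebra ℂ X where
  __ := weakClosure (xDual F) (sandwich J)
  mul_mem' := by
    refine hF.mul_mem_weakClosure_span ?_
    rintro _ ⟨j₁, hj₁, j₂, -, x, rfl⟩ _ ⟨j₃, -, j₄, hj₄, y, rfl⟩
    have hassoc : j₁ * x * star j₂ * (j₃ * y * star j₄) =
        j₁ * (x * star j₂ * (j₃ * y)) * star j₄ := by simp only [mul_assoc]
    rw [hassoc]
    exact le_weakClosure _ _ (mul_mul_star_mem_sandwich hj₁ _ hj₄)
  star_mem' := by
    refine hF.star_mem_weakClosure_span ?_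
    rintro _ ⟨j₁, hj₁, j₂, hj₂, x, rfl⟩
    rw [star_mul, star_mul, star_star, ← mul_assoc]
    exact le_weakClosure _ _ (mul_mul_star_mem_sandwich hj₂ _ hj₁)

lemma weakClosure_hereditarySubalgebra_le (hF : IsCStarDualPair F) (J : Submodule ℂ X) :
    weakClosure (xDual F) (hereditarySubalgebra hF J).toSubmodule ≤
      (hereditarySubalgebra hF J).toSubmodule := weakClosure_weakClosure_le _ _

lemma mul_star_mul_mul_star_ne_zero {A : Type*} [NonUnitalNormedRing A] [StarRing A]
    [CStarRing A] {a : A} (ha : a ≠ 0) : a * (star a * a) * star a ≠ 0 := by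
  have hsq : a * (star a * a) * star a = (a * star a) * star (a * star a) := by
    simp only [star_mul, star_star, mul_assoc]
  rw [hsq, Ne, CStarRing.mul_star_self_eq_zero_iff, CStarRing.mul_star_self_eq_zero_iff]
  exact ha

variable [PartialOrder X] [StarOrderedRing X]

lemma mem_hereditarySubalgebra_of_le (hF : IsCStarDualPair F) (J : Submodule ℂ X) {x y : X}
    (hx : 0 ≤ x) (hxy : x ≤ y) (hy : y ∈ hereditarySubalgebra hF J) :
    x ∈ hereditarySubalgebra hF J := by
  obtain ⟨b, rfl⟩ := CStarAlgebra.nonneg_iff_eq_mul_star_self.1 hx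
  obtain ⟨l, _, hl, hunit⟩ := exists_approximateUnit (hereditarySubalgebra hF J)
    (isClosed_of_weakClosure_le (weakClosure_hereditarySubalgebra_le hF J))
  have hb : b ∈ weakClosure (xDual F) (Submodule.span ℂ {z | ∃ j ∈ J, ∃ x, z = j * x}) := by
    refine weakClosure_weakClosure_le _ _ (mem_weakClosure_of_tendsto
      (fun _ => continuous_of_mem_xDual) (hl.mono fun u hu => ?_) (hunit y hy b hxy))
    refine (hF.weaklyContinuous_mul_right b).map_mem_span ?_ hu
    rintro _ ⟨j₁, hj₁, j₂, -, x, rfl⟩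
    exact le_weakClosure _ _ (Submodule.subset_span
      ⟨j₁, hj₁, x * star j₂ * b, by simp only [mul_assoc]⟩)
  have hstar : star b ∈
      weakClosure (xDual F) (Submodule.span ℂ {z | ∃ j ∈ J, ∃ x, z = x * star j}) := by
    refine hF.star_mem_weakClosure_span ?_ hb
    rintro _ ⟨j, hj, x, rfl⟩
    exact le_weakClosure _ _ (Submodule.subset_span ⟨j, hj, star x, star_mul _ _⟩)
  refine hF.mul_mem_weakClosure_span ?_ hb hstar
  rintro _ ⟨j₁, hj₁, x, rfl⟩ _ ⟨j₂, hj₂, z, rfl⟩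
  rw [← mul_assoc, mul_assoc j₁]
  exact le_weakClosure _ _ (mul_mul_star_mem_sandwich hj₁ _ hj₂)

lemma isInvariantHereditary_hereditarySubalgebra {G : Type*} [Group G] [TopologicalSpace G]
    {α : G →* (X ≃⋆ₐ[ℂ] X)} (hF : IsCStarDualPair F) (hα : IsFDynamicalSystem F α)
    {J : Submodule ℂ X} (hJ : J ≠ ⊥) (hJfix : J ≤ (fixedPts α).toSubmodule) :
    IsInvariantHereditary F α (hereditarySubalgebra hF J) where
  ne_bot := by
    obtain ⟨j, hj, hj0⟩ := Submodule.exists_mem_ne_zero_of_ne_bot hJ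
    exact ⟨_, le_weakClosure _ _ (mul_mul_star_mem_sandwich hj _ hj),
      mul_star_mul_mul_star_ne_zero hj0⟩
  isClosed := (isClosed_fTopology_iff (hereditarySubalgebra hF J).toSubmodule).2
    (weakClosure_hereditarySubalgebra_le hF J)
  invariant g y hy := by
    refine (hα.weaklyContinuous g).map_mem_span ?_ hy
    rintro _ ⟨j₁, hj₁, j₂, hj₂, x, rfl⟩
    rw [map_mul, map_mul, map_star, hJfix hj₁ g, hJfix hj₂ g]
    exact le_weakClosure _ _ (mul_mul_star_mem_sandwich hj₁ _ hj₂)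
  hereditary _ _ hx hxy hy := mem_hereditarySubalgebra_of_le hF J hx hxy hy

end HereditarySubalgebra

section FixedPointsSimple

variable {X : Type*} [NonUnitalCStarAlgebra X]
  {G : Type*} [Group G] [TopologicalSpace G] [IsTopologicalGroup G] [CompactSpace G]
  [MeasurableSpace G] [BorelSpace G]
  {F : Submodule ℂ (StrongDual ℂ X)} {α : G →* (X ≃⋆ₐ[ℂ] X)}

lemma avg_one_of_mem_fixedPts (hF : IsCStarDualPair F) (hα : IsFDynamicalSystem F α) {z : X}
    (hz : z ∈ fixedPts α) : avg F α (fun _ => 1) z = z :=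
  avg_eq hF hα continuous_const fun φ _ => by simp [hz _]

lemma IsRow.avg_mul (hF : IsCStarDualPair F) (hα : IsFDynamicalSystem F α) {π : IrrRep G}
    {a : Fin π.dim → X} (ha : IsRow α π a) (k : Fin π.dim) (x : X) :
    avg F α (fun _ => 1) (a k * x) = ∑ m, a m * avg F α (fun g => π.mat g m k) x := by
  have hc := continuous_mat π
  refine avg_eq hF hα continuous_const fun φ hφ => ?_
  choose ψ hψ hψφ using fun m =>
    weaklyContinuous_xDual_iff.1 (hF.weaklyContinuous_mul_left (a m)) φ hφ
  rw [map_sum]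
  simp only [← hψφ, apply_avg hF hα (hc _ _) _ (hψ _), one_mul, map_mul, ha _ k, Finset.sum_mul,
    smul_mul_assoc, map_sum, map_smul, smul_eq_mul]
  rw [integral_finsetSum]
  exact fun m _ => integrable_of_continuous ((hc m k).mul (hα.continuous_orbit x _ (hψ m)))

variable {J : Submodule ℂ X}

/-- By `IsRow.sum_avg`, the row `q` may be replaced by averages of its entries. On elements of
`J X J*` averaging pulls out the left factor in `J`, and what remains is a fixed point. -/
lemma sum_mul_star_mem_weakClosure (hF : IsCStarDualPair F) (hα : IsFDynamicalSystem F α)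
    (hJfix : J ≤ (fixedPts α).toSubmodule)
    (hJmul : ∀ x ∈ J, ∀ b ∈ fixedPts α, b * x ∈ J ∧ x * b ∈ J) {π : IrrRep G}
    {q b : Fin π.dim → X} (hq : IsRow α π q) (hqJ : ∀ k, q k ∈ hereditarySubalgebra hF J)
    (hb : IsRow α π b) : ∑ l, q l * star (b l) ∈ weakClosure (xDual F) J := by
  have hc (l k : Fin π.dim) : Continuous fun g => star (π.mat g l k) := (continuous_mat π l k).star
  have hsum : ∑ l, q l * star (b l) =
      ∑ k, ∑ l, avg F α (fun g => star (π.mat g l k)) (q k) * star (b l) := by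
    rw [Finset.sum_comm]
    simp only [← Finset.sum_mul, hq.sum_avg hF hα]
  have hcont (k : Fin π.dim) : WeaklyContinuous (xDual F) (xDual F)
      (fun x => ∑ l, avg F α (fun g => star (π.mat g l k)) x * star (b l)) :=
    .sum fun l _ =>
      (hF.weaklyContinuous_mul_right (star (b l))).comp (weaklyContinuous_avg hF hα (hc l k))
  rw [hsum]
  refine sum_mem fun k _ => (hcont k).map_mem_span ?_ (hqJ k)
  rintro _ ⟨j₁, hj₁, j₂, hj₂, x, rfl⟩
  have hpull : ∑ l, avg F α (fun g => star (π.mat g l k)) (j₁ * x * star j₂) * star (b l) =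
      j₁ * ∑ l, avg F α (fun g => star (π.mat g l k)) x * star (b l * j₂) := by
    rw [Finset.mul_sum]
    refine Finset.sum_congr rfl fun l _ => ?_
    rw [FDyn.avg_mul hF hα (hc l k) (star_mem (hJfix hj₂) : star j₂ ∈ fixedPts α),
      mul_avg hF hα (hc l k) (hJfix hj₁), star_mul]
    simp only [mul_assoc]
  rw [hpull]
  exact le_weakClosure _ _ (hJmul _ hj₁ _
    ((isRow_avg hF hα π k x).sum_mul_star_mem (hb.mul_right (hJfix hj₂)))).2

variable [PartialOrder X] [StarOrderedRing X]

/-- The diagonal matrix `w ⊗ 1` is a fixed point over the hereditary subalgebra generated by `J`,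
so the strong Connes spectrum approximates it by products of rows. -/
lemma sum_mul_mul_star_mem_weakClosure (hF : IsCStarDualPair F) (hα : IsFDynamicalSystem F α)
    (hsp : spectrumOf F α ⊆ strongConnesSpectrum F α) (hJ : J ≠ ⊥)
    (hJfix : J ≤ (fixedPts α).toSubmodule)
    (hJmul : ∀ x ∈ J, ∀ b ∈ fixedPts α, b * x ∈ J ∧ x * b ∈ J) {c : DualSet G}
    {a b : Fin c.rep.dim → X} (ha : IsRow α c.rep a) (hb : IsRow α c.rep b) {w : X}
    (hw : w ∈ hereditarySubalgebra hF J ⊓ fixedPts α) :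
    ∑ k, a k * w * star (b k) ∈ weakClosure (xDual F) J := by
  by_cases! ha0 : ∀ k, a k = 0
  · simp [ha0]
  have hdense := (mem_strongConnesSpectrum_iff hF hα).1
    (hsp ((mem_spectrumOf_iff hF hα).2 ⟨a, ha, ha0⟩)) _
    (isInvariantHereditary_hereditarySubalgebra hF hα hJ hJfix)
    (diagonal_mem_fixedAlgebra hw c.rep)
  rw [spectralIdeal_eq_span] at hdense
  have hcont : WeaklyContinuous (matDual F c.rep.dim) (xDual F)
      (fun M : Matrix (Fin c.rep.dim) (Fin c.rep.dim) X => ∑ k, ∑ l, a k * M k l * star (b l)) :=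
    .sum fun k _ => .sum fun l _ => (hF.weaklyContinuous_mul_right _).comp
      ((hF.weaklyContinuous_mul_left _).comp (weaklyContinuous_entry k l))
  have hmem := hcont.map_mem_span (R := J) ?_ hdense
  · simpa [Matrix.diagonal_apply, mul_ite, ite_mul] using hmem
  · rintro _ ⟨p, q, hp, hq, -, hqJ, rfl⟩
    have hfactor : ∑ k, ∑ l, a k * outer p q k l * star (b l) =
        (∑ k, a k * star (p k)) * ∑ l, q l * star (b l) := by
      simp only [Finset.sum_mul_sum, outer, vecMulVec_apply, Pi.star_apply, mul_assoc]
    rw [hfactor]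
    exact (hF.weaklyContinuous_mul_left _).map_mem
      (fun s hs => le_weakClosure _ _ (hJmul s hs _ (ha.sum_mul_star_mem hp)).1)
      (sum_mul_star_mem_weakClosure hF hα hJfix hJmul hq hqJ hb)

lemma avg_mul_mul_mem_weakClosure (hF : IsCStarDualPair F) (hα : IsFDynamicalSystem F α)
    (hsp : spectrumOf F α ⊆ strongConnesSpectrum F α) (hJ : J ≠ ⊥)
    (hJfix : J ≤ (fixedPts α).toSubmodule)
    (hJmul : ∀ x ∈ J, ∀ b ∈ fixedPts α, b * x ∈ J ∧ x * b ∈ J) {w : X}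
    (hw : w ∈ hereditarySubalgebra hF J ⊓ fixedPts α) (x y : X) :
    avg F α (fun _ => 1) (x * w * y) ∈ weakClosure (xDual F) J := by
  have hx : x ∈ weakClosure (xDual F) (Submodule.span ℂ
      {z | ∃ (c : DualSet G) (a : Fin c.rep.dim → X), IsRow α c.rep a ∧ ∃ k, z = a k}) := by
    refine mem_weakClosure_of_rows hF hα (Y := ⊤) (fun _ _ => trivial) (fun _ _ _ => trivial)
      (fun c a ha _ k => le_weakClosure _ _ (Submodule.subset_span ?_)) trivial
    exact ⟨c, a, ha, k, rfl⟩
  rw [mul_assoc]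
  refine ((weaklyContinuous_avg hF hα continuous_const).comp
    (hF.weaklyContinuous_mul_right (w * y))).map_mem_span ?_ hx
  rintro _ ⟨c, a, ha, k, rfl⟩
  have hc := continuous_mat c.rep
  have hterm (m : Fin c.rep.dim) : a m * avg F α (fun g => c.rep.mat g m k) (w * y) =
      a m * w * star (avg F α (fun g => star (c.rep.mat g m k)) (star y)) := by
    rw [star_avg hF hα (hc m k).star, mul_avg hF hα (hc m k) hw.2]
    simp only [star_star, mul_assoc]
  rw [ha.avg_mul hF hα]
  simp only [hterm]
  exact sum_mul_mul_star_mem_weakClosure hF hα hsp hJ hJfix hJmul ha (isRow_avg hF hα _ k _) hw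

lemma IsAlphaSimple.isFixedPtsSimple (hF : IsCStarDualPair F) (hα : IsFDynamicalSystem F α)
    (hsimple : IsAlphaSimple F α) (hsp : spectrumOf F α ⊆ strongConnesSpectrum F α) :
    IsFixedPtsSimple F α := by
  intro J hJ hJfix hJmul z hz
  let A : Set X := {z | ∃ w ∈ hereditarySubalgebra hF J ⊓ fixedPts α, ∃ x y, z = x * w * y}
  have hideal : ∀ s ∈ A, ∀ b ∈ (Set.univ : Set X),
      b * s ∈ Submodule.span ℂ A ∧ s * b ∈ Submodule.span ℂ A := by
    rintro _ ⟨w, hw, x, y, rfl⟩ b -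
    exact ⟨Submodule.subset_span ⟨w, hw, b * x, y, by simp only [mul_assoc]⟩,
      Submodule.subset_span ⟨w, hw, x, y * b, by simp only [mul_assoc]⟩⟩
  have hne : Submodule.span ℂ A ≠ ⊥ := by
    obtain ⟨w, hw, hw0⟩ :=
      (isInvariantHereditary_hereditarySubalgebra hF hα hJ hJfix).exists_fixedPts_ne_zero hF hα
    refine (Submodule.ne_bot_iff _).2 ⟨w * (star w * w) * star w, ?_,
      mul_star_mul_mul_star_ne_zero hw0⟩
    exact Submodule.subset_span ⟨w, hw, w * star w, star w, by simp only [mul_assoc]⟩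
  have hinv (g : G) : Submodule.span ℂ A ≤
      (Submodule.span ℂ A).comap (α g : X →ₗ[ℂ] X) := by
    refine Submodule.span_le.2 ?_
    rintro _ ⟨w, hw, x, y, rfl⟩
    refine Submodule.subset_span ⟨w, hw, α g x, α g y, ?_⟩
    change α g (x * w * y) = _
    rw [map_mul, map_mul, hw.2 g]
  have hdense := hsimple (Submodule.span ℂ A) hne
    (fun x hx b => mul_mem_span_of_mul_mem hideal x hx b trivial) fun g _ hx => hinv g hx
  rw [closure_fTopology] at hdense
  rw [← avg_one_of_mem_fixedPts hF hα hz]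
  refine (weaklyContinuous_avg hF hα continuous_const).map_mem_span ?_ (hdense.ge (Set.mem_univ z))
  rintro _ ⟨w, hw, x, y, rfl⟩
  exact avg_mul_mul_mem_weakClosure hF hα hsp hJ hJfix hJmul hw x y

lemma exists_mem_spectrumOf_mat_eq_one [Nontrivial X] (hF : IsCStarDualPair F)
    (hα : IsFDynamicalSystem F α) : ∃ c ∈ spectrumOf F α, ∀ g, c.rep.mat g = 1 := by
  obtain ⟨c, hc⟩ := exists_rep_mat_eq_one G
  obtain ⟨s, hs, hs0⟩ :=
    (isInvariantHereditary_top (F := F) (α := α)).exists_fixedPts_ne_zero hF hα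
  exact ⟨c, (mem_spectrumOf_iff hF hα).2 ⟨_, isRow_const hc hs.2, ⟨0, c.rep.dim_pos⟩, hs0⟩, hc⟩

end FixedPointsSimple

end FDyn

end

theorem theorem3p6_general {X : Type*} [NonUnitalCStarAlgebra X] [PartialOrder X]
    [StarOrderedRing X] [Nontrivial X]
    {G : Type*} [Group G] [TopologicalSpace G] [IsTopologicalGroup G] [CompactSpace G]
    [MeasurableSpace G] [BorelSpace G]
    (F : Submodule ℂ (StrongDual ℂ X)) (hF : FDyn.IsCStarDualPair F)
    (α : G →* (X ≃⋆ₐ[ℂ] X)) (hα : FDyn.IsFDynamicalSystem F α) :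
    (∀ π ∈ FDyn.spectrumOf F α, FDyn.IsFSimple F (FDyn.fixedAlgebra α ⊤ π.rep)) ↔
      (FDyn.IsAlphaSimple F α ∧ FDyn.spectrumOf F α = FDyn.strongConnesSpectrum F α) := by
  constructor
  · intro h
    obtain ⟨c, hc, hc1⟩ := FDyn.exists_mem_spectrumOf_mat_eq_one hF hα
    have hfix := FDyn.IsFixedPtsSimple.of_isFSimple hc1 (h c hc)
    exact ⟨hfix.isAlphaSimple hF hα, subset_antisymm
      (fun π hπ => hfix.mem_strongConnesSpectrum hF hα hπ (h π hπ))
      (FDyn.strongConnesSpectrum_subset hF hα)⟩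
  · rintro ⟨hsimple, hsp⟩ π hπ
    exact (hsimple.isFixedPtsSimple hF hα hsp.subset).isFSimple hF hα (hsp ▸ hπ)

theorem theorem3p6 {X : Type*} [NonUnitalCStarAlgebra X] [PartialOrder X] [StarOrderedRing X]
    [Nontrivial X]
    {G : Type*} [Group G] [TopologicalSpace G] [IsTopologicalGroup G] [CompactSpace G] [T2Space G]
    [MeasurableSpace G] [BorelSpace G]
    (F : Submodule ℂ (StrongDual ℂ X)) (hF : FDyn.IsCStarDualPair F)
    (α : G →* (X ≃⋆ₐ[ℂ] X)) (hα : FDyn.IsFDynamicalSystem F α) :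
    (∀ π ∈ FDyn.spectrumOf F α, FDyn.IsFSimple F (FDyn.fixedAlgebra α ⊤ π.rep)) ↔
      (FDyn.IsAlphaSimple F α ∧ FDyn.spectrumOf F α = FDyn.strongConnesSpectrum F α) :=
  theorem3p6_general F hF α hα
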